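/- Let $\mathcal X$ be a measurable space, $\mathcal Y=\{-1,1\}$, $P$ a probability measure on $\mathcal X\times\mathcal Y$, and $S_n=((X_1,Y_1),\dots,(X_n,Y_n))\sim P^{n}$ an i.i.d. sample of size $n\ge 1$ with empirical measure $P_n=\frac1n\sum_{i=1}^n\delta_{(X_i,Y_i)}$. Let $\mathcal H$ be a real separable Hilbert space with orthonormal basis $(e_j)_{j\in J}$, where $J$ is countable (possibly finite) and enumerated, and let $\varphi:\mathcal X\to\mathcal H$ be a measurable feature map with $\|\varphi(x)\|\le 1$ for all $x$. For $\lambda>0$ let $W_n=\operatorname{SVM}_\lambda(S_n)\in\mathcal H$ be the (unique) minimizer over $w\in\mathcal H$ of $$\frac{\lambda}{2}\|w\|^2+\frac1n\sum_{i=1}^n\max\bigl(0,\,1-Y_i\langle w,\varphi(X_i)\rangle\bigr).$$ For $w\in\mathcal H$ and $\sigma>0$ let $\mathcal N(w,\sigma^2I)$ be the product measure $\bigotimes_{j\in J}\mathcal N(\langle e_j,w\rangle,\sigma^2)$ on $\mathbb R^{J}$. A weight sequence $v\in\mathbb R^J$ predicts on the input $x$ with $\langle v,\varphi(x)\rangle=\sum_{j}v_j\langle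 e_j,\varphi(x)\rangle$, the sum being taken in the order of the enumeration (for each $x$ it converges for $\mathcal N(w,\sigma^2I)$-almost every $v$). Let $\ell:\mathbb R\times\mathcal Y\to[0,1]$ be a measurable loss function (for instance the 0-1 loss $\ell(t,y)=\mathbf 1[\operatorname{sign}(t)\ne y]$ of the linear classifier, or the clipped hinge loss). For a probability measure $Q$ on $\mathbb R^J$ and a probability measure $\nu$ on $\mathcal X\times\mathcal Y$ put $$R(Q,\nu)=\int_{\mathbb R^J}\int_{\mathcal X\times\mathcal Y}\ell\bigl(\langle v,\varphi(x)\rangle,y\bigr)\,d\nu(x,y)\,dQ(v).$$ For $q,p\in[0,1]$ put $\operatorname{kl}_+(q\,\|\,p)=q\log\frac qp+(1-q)\log\frac{1-q}{1-p}$ if $q<p$ (with $0\log 0=0$, and with value $+\infty$ if $q<p=1$), and $\operatorname{kl}_+(q\,\|\,p)=0$ otherwise. Then for every $\sigma>0$ and every $\delta\in(0,1)$, with $Q=\mathcal N(W_n,\sigma^2I)$, with probability at least $1-2\delta$ over $S_n\sim P^n$, $$\operatorname{kl}_+\bigl(R(Q,P_n)\,\big\|\,R(Q,P)\bigr)\le\frac{\frac{2}{\sigma^2\lambda^2n}\Bigl(1+\sqrt{\tfrac12\log\frac1\delta}\Bigr)^2+\log\frac{n+1}{\delta}}{n}.$$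 -/

import Mathlib

open MeasureTheory ProbabilityTheory Filter Topology
open scoped NNReal ENNReal

noncomputable section

namespace PacBayesSVM

/-- The labels of binary classification, `{-1, 1}`. -/
abbrev Label : Type := ({-1, 1} : Set ℝ)

section SVM

variable {X H : Type*} [NormedAddCommGroup H] [InnerProductSpace ℝ H]

/-- The hinge loss of the real-valued prediction `t` on the label `y`. -/
def hingeLoss (t : ℝ) (y : Label) : ℝ := max 0 (1 - (y : ℝ) * t)

/-- The regularized empirical hinge risk
`(l / 2) ‖w‖² + (1 / n) ∑ i, hinge (⟪w, φ xᵢ⟫, yᵢ)`. -/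
def svmObjective (φ : X → H) (l : ℝ) {n : ℕ} (s : Fin n → X × Label) (w : H) : ℝ :=
  l / 2 * ‖w‖ ^ 2 + 1 / (n : ℝ) * ∑ i, hingeLoss (inner ℝ w (φ (s i).1)) (s i).2

/-- `w` solves the SVM optimization problem on the sample `s`. -/
def IsSVMSolution (φ : X → H) (l : ℝ) {n : ℕ} (s : Fin n → X × Label) (w : H) : Prop :=
  ∀ w' : H, svmObjective φ l s w ≤ svmObjective φ l s w'

/-- The SVM weight vector: the minimizer over `w : H` of the regularized empirical hinge risk
(it exists and is unique for `l > 0`, see `existsUnique_isSVMSolution`). -/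
def svm (φ : X → H) (l : ℝ) {n : ℕ} (s : Fin n → X × Label) : H :=
  Classical.epsilon (IsSVMSolution φ l s)

theorem svmObjective_midpoint (φ : X → H) (l : ℝ) {n : ℕ} (s : Fin n → X × Label) (u v : H) :
    svmObjective φ l s ((1 / 2 : ℝ) • (u + v)) + l / 8 * ‖u - v‖ ^ 2
      ≤ (svmObjective φ l s u + svmObjective φ l s v) / 2 := by
  have hpar := parallelogram_law_with_norm ℝ u v
  have hn : ‖(1 / 2 : ℝ) • (u + v)‖ ^ 2 = 1 / 4 * ‖u + v‖ ^ 2 := by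
    rw [norm_smul, mul_pow]; norm_num
  have hs : ∑ i, hingeLoss (inner ℝ ((1 / 2 : ℝ) • (u + v)) (φ (s i).1)) (s i).2
      ≤ (∑ i, hingeLoss (inner ℝ u (φ (s i).1)) (s i).2
        + ∑ i, hingeLoss (inner ℝ v (φ (s i).1)) (s i).2) / 2 := by
    rw [← Finset.sum_add_distrib, Finset.sum_div]
    refine Finset.sum_le_sum fun i _ => ?_
    unfold hingeLoss
    rw [inner_smul_left, inner_add_left]
    simp only [conj_trivial]
    have h1 := le_max_left 0 (1 - ((s i).2 : ℝ) * inner ℝ u (φ (s i).1))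
    have h2 := le_max_right 0 (1 - ((s i).2 : ℝ) * inner ℝ u (φ (s i).1))
    have h3 := le_max_left 0 (1 - ((s i).2 : ℝ) * inner ℝ v (φ (s i).1))
    have h4 := le_max_right 0 (1 - ((s i).2 : ℝ) * inner ℝ v (φ (s i).1))
    apply max_le
    · linarith
    · linarith
  have hs' := mul_le_mul_of_nonneg_left hs (by positivity : (0 : ℝ) ≤ 1 / (n : ℝ))
  unfold svmObjective
  rw [hn]
  have hpar' : l / 8 * ‖u + v‖ ^ 2 + l / 8 * ‖u - v‖ ^ 2
      = l / 4 * ‖u‖ ^ 2 + l / 4 * ‖v‖ ^ 2 := by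
    linear_combination (l / 8) * hpar
  linarith

theorem continuous_svmObjective (φ : X → H) (l : ℝ) {n : ℕ} (s : Fin n → X × Label) :
    Continuous (svmObjective φ l s) := by
  unfold svmObjective hingeLoss
  fun_prop

theorem svmObjective_nonneg (φ : X → H) {l : ℝ} (hl : 0 < l) {n : ℕ} (s : Fin n → X × Label)
    (w : H) : 0 ≤ svmObjective φ l s w := by
  unfold svmObjective hingeLoss
  have : 0 ≤ ∑ i, max 0 (1 - ((s i).2 : ℝ) * inner ℝ w (φ (s i).1)) :=
    Finset.sum_nonneg fun i _ => le_max_left _ _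
  positivity

theorem existsUnique_isSVMSolution [CompleteSpace H] (φ : X → H) {l : ℝ} (hl : 0 < l) {n : ℕ}
    (s : Fin n → X × Label) : ∃! w, IsSVMSolution φ l s w := by
  have hbdd : BddBelow (Set.range (svmObjective φ l s)) :=
    ⟨0, by rintro _ ⟨w, rfl⟩; exact svmObjective_nonneg φ hl s w⟩
  set m := ⨅ w, svmObjective φ l s w with hm
  have hle : ∀ w, m ≤ svmObjective φ l s w := fun w => ciInf_le hbdd w
  have hdist : ∀ (u v : H) (e : ℝ), svmObjective φ l s u ≤ m + e → svmObjective φ l s v ≤ m + e →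
      ‖u - v‖ ^ 2 ≤ 8 * e / l := by
    intro u v e hu hv
    have h := svmObjective_midpoint φ l s u v
    have h' := hle ((1 / 2 : ℝ) • (u + v))
    rw [le_div_iff₀ hl]
    linarith
  have hseq : ∀ k : ℕ, ∃ u, svmObjective φ l s u < m + 1 / ((k : ℝ) + 1) := fun k =>
    exists_lt_of_ciInf_lt (lt_add_of_pos_right m Nat.one_div_pos_of_nat)
  choose u hu using hseq
  have hb : Tendsto (fun k : ℕ => Real.sqrt (8 * (1 / ((k : ℝ) + 1)) / l)) atTop (𝓝 0) := by
    have h := ((tendsto_one_div_add_atTop_nhds_zero_nat (𝕜 := ℝ)).const_mul 8).div_const l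
    simpa using h.sqrt
  have hc : CauchySeq u := by
    refine cauchySeq_of_le_tendsto_0 _ (fun a b N ha hb => ?_) hb
    rw [dist_eq_norm]
    apply Real.le_sqrt_of_sq_le
    apply hdist
    · exact (hu a).le.trans (by gcongr)
    · exact (hu b).le.trans (by gcongr)
  obtain ⟨w, hw⟩ := cauchySeq_tendsto_of_complete hc
  have hwm : svmObjective φ l s w ≤ m := by
    have h1 := ((continuous_svmObjective φ l s).tendsto w).comp hw
    have h2 : Tendsto (fun k : ℕ => m + 1 / ((k : ℝ) + 1)) atTop (𝓝 m) := by
      simpa using (tendsto_one_div_add_atTop_nhds_zero_nat (𝕜 := ℝ)).const_add m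
    exact le_of_tendsto_of_tendsto' h1 h2 fun k => (hu k).le
  refine ⟨w, fun w' => hwm.trans (hle w'), fun v hv => ?_⟩
  have h := hdist v w 0 (by simpa using (hv w).trans hwm) (by simpa using hwm)
  have h0 : ‖v - w‖ ^ 2 = 0 := le_antisymm (by simpa using h) (sq_nonneg _)
  exact sub_eq_zero.mp (norm_eq_zero.mp (pow_eq_zero_iff two_ne_zero |>.mp h0))

theorem isSVMSolution_svm [CompleteSpace H] (φ : X → H) {l : ℝ} (hl : 0 < l) {n : ℕ}
    (s : Fin n → X × Label) : IsSVMSolution φ l s (svm φ l s) :=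
  Classical.epsilon_spec (existsUnique_isSVMSolution φ hl s).exists

end SVM

section Gaussian

variable {ι H : Type*} [NormedAddCommGroup H] [InnerProductSpace ℝ H]

/-- The Gaussian distribution `N(w, σ² I)`: in the coordinates of the orthonormal basis `b`, the
product over `i : ι` of the real Gaussians `N(⟪b i, w⟫, σ²)`.  When `H` is infinite-dimensional
it is a probability measure on the sequence space, and not on (the copy of) `H` in it. -/
def gaussian (b : HilbertBasis ι ℝ H) (w : H) (σ : ℝ) : Measure (ι → ℝ) :=
  Measure.infinitePi fun i => gaussianReal (inner ℝ (b i) w) (σ ^ 2).toNNReal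

/-- The real-valued prediction `⟪v, h⟫ = ∑ i, v i * ⟪b i, h⟫` of the (random) weight sequence `v`
on the feature vector `h`, the series being summed in the order in which `ι` is enumerated.
It is the limit of the partial sums, which exists for `gaussian b w σ`-almost every `v`.
(For an infinite `ι` the series is in general not absolutely convergent, so `tsum` would not
do.) -/
def score [Encodable ι] (b : HilbertBasis ι ℝ H) (v : ι → ℝ) (h : H) : ℝ :=
  limUnder atTop fun N : ℕ =>
    ∑ i ∈ (Finset.range N).preimage Encodable.encode Encodable.encode_injective.injOn,
      v i * inner ℝ (b i) h

end Gaussian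

section Risk

variable {X : Type*} [MeasurableSpace X]

/-- The risk `R(c, ν) = ∫ ℓ(c(x), y) dν(x, y)` of the predictor `c`. -/
def risk (ℓ : ℝ → Label → ℝ) (c : X → ℝ) (ν : Measure (X × Label)) : ℝ :=
  ∫ z, ℓ (c z.1) z.2 ∂ν

/-- The empirical measure `Pₙ = (1 / n) ∑ i, δ_{(xᵢ, yᵢ)}` of a sample. -/
def empiricalMeasure {n : ℕ} (s : Fin n → X × Label) : Measure (X × Label) :=
  (n : ℝ≥0∞)⁻¹ • ∑ i, Measure.dirac (s i)

/-- The average risk `R(Q, ν) = ∫ R(c_v, ν) dQ(v)` of the randomized predictor that draws a weight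
sequence `v` from `Q` and predicts with `c_v(x) = ⟪v, φ x⟫`.  The loss acts on the real-valued
prediction; the 0-1 loss of the linear classifier `sign ⟪v, φ x⟫` is the case
`ℓ t y = if Real.sign t = y then 0 else 1`. -/
def avgRisk {ι H : Type*} [Encodable ι] [NormedAddCommGroup H] [InnerProductSpace ℝ H]
    (b : HilbertBasis ι ℝ H) (φ : X → H) (ℓ : ℝ → Label → ℝ)
    (Q : Measure (ι → ℝ)) (ν : Measure (X × Label)) : ℝ :=
  ∫ v, risk ℓ (fun x => score b v (φ x)) ν ∂Q

end Risk

/-- `KL₊(q ‖ p) = KL(q ‖ p) 1[q < p]` for Bernoulli parameters `q, p ∈ [0, 1]`, where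
`KL(q ‖ p) = q log (q / p) + (1 - q) log ((1 - q) / (1 - p))`, with the conventions `0 log 0 = 0`
and `KL(q ‖ 1) = ∞` for `q < 1`. -/
def klPlus (q p : ℝ) : EReal :=
  if q < p then
    if p = 1 then ⊤
    else ((q * Real.log (q / p) + (1 - q) * Real.log ((1 - q) / (1 - p)) : ℝ) : EReal)
  else 0

end PacBayesSVM

end

/-! A PAC-Bayes prior must not depend on the sample, but it need not be known. The prior here is the
Gaussian with the same variance as the posterior, centred at the mean `w₀` of the SVM vector `W`
under the law of the sample. The relative entropy of the posterior is then at most `‖W - w₀‖² /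
(2σ²)`, so the bound rests on the concentration of `W` around its mean.

Concentration comes from stability. The regularized objective is strongly convex, so replacing one
example moves its minimizer by at most `c = 2 / (l n)` (`IsSVMSolution.norm_sub_le`). Orthogonality
of martingale increments gives `E‖W - w₀‖² ≤ n c²`, and McDiarmid's inequality for the scalar `‖W -
w₀‖` controls its deviation from its mean. Hence `‖W - w₀‖ < c √n (1 + √(log(1/δ) / 2))` outside an
event of probability at most `δ` (`HasBoundedDifferences.measure_norm_sub_ge_le`).

The other `δ` pays for a PAC-Bayes-kl inequality that is uniform in the posterior
(`pacBayes_klPlus`). The divergence is a supremum of the functions `-L q - log(1 - p + p exp(-L))`,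
which are jointly convex in `(q, p)`. The exponential of `n` times this supremum has mean at most `n
+ 1`, because it is dominated by `n + 1` times a uniform mixture over `θ` of Bernoulli likelihood
ratios (`lintegral_iSup_exp_klMinorant_le`). Markov's inequality, change of measure and Jensen's
inequality finish the argument.

Relative entropy is used only in its dual form `RelEntropyLE`. In this form a bound uniform over
finite sets of coordinates passes to the infinite product by martingale convergence, with no density
on the sequence space. -/

namespace PacBayesSVM

/-! ### Stability, boundedness and measurability of the SVM solution. -/

section SVMStability

variable {X H : Type*} [NormedAddCommGroup H] [InnerProductSpace ℝ H]

theorem Label.abs_eq_one (y : Label) : |(y : ℝ)| = 1 := by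
  rcases y with ⟨y, rfl | rfl⟩ <;> simp

theorem hingeLoss_sub_le (y : Label) (t t' : ℝ) : hingeLoss t y - hingeLoss t' y ≤ |t - t'| := by
  unfold hingeLoss
  have h := abs_max_sub_max_le_abs (1 - (y : ℝ) * t) (1 - (y : ℝ) * t') 0
  rw [max_comm, max_comm _ (0 : ℝ)] at h
  have h2 : |1 - (y : ℝ) * t - (1 - (y : ℝ) * t')| = |t - t'| := by
    rw [show 1 - (y : ℝ) * t - (1 - (y : ℝ) * t') = -(y * (t - t')) by ring, abs_neg, abs_mul,
      y.abs_eq_one, one_mul]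
  exact (le_abs_self _).trans (h.trans h2.le)

theorem hingeLoss_convexComb_le (y : Label) (u v : ℝ) {t : ℝ} (h0 : 0 ≤ t) (h1 : t ≤ 1) :
    hingeLoss ((1 - t) * u + t * v) y ≤ (1 - t) * hingeLoss u y + t * hingeLoss v y := by
  unfold hingeLoss
  have a1 := le_max_left 0 (1 - (y : ℝ) * u)
  have a2 := le_max_right 0 (1 - (y : ℝ) * u)
  have a3 := le_max_left 0 (1 - (y : ℝ) * v)
  have a4 := le_max_right 0 (1 - (y : ℝ) * v)
  have b1 := mul_le_mul_of_nonneg_left a1 (sub_nonneg.2 h1)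
  have b2 := mul_le_mul_of_nonneg_left a2 (sub_nonneg.2 h1)
  have b3 := mul_le_mul_of_nonneg_left a3 h0
  have b4 := mul_le_mul_of_nonneg_left a4 h0
  apply max_le
  · linarith
  · linarith

theorem svmObjective_convexComb_le (φ : X → H) (l : ℝ) {n : ℕ} (s : Fin n → X × Label) (u v : H)
    {t : ℝ} (h0 : 0 ≤ t) (h1 : t ≤ 1) :
    svmObjective φ l s ((1 - t) • u + t • v) + l / 2 * (t * (1 - t)) * ‖v - u‖ ^ 2
      ≤ (1 - t) * svmObjective φ l s u + t * svmObjective φ l s v := by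
  have hn : ‖(1 - t) • u + t • v‖ ^ 2 + t * (1 - t) * ‖v - u‖ ^ 2
      = (1 - t) * ‖u‖ ^ 2 + t * ‖v‖ ^ 2 := by
    simp only [← real_inner_self_eq_norm_sq, inner_add_left, inner_add_right, inner_sub_left,
      inner_sub_right, real_inner_smul_left, real_inner_smul_right]
    rw [real_inner_comm u v]
    ring
  have hs : ∑ i, hingeLoss (inner ℝ ((1 - t) • u + t • v) (φ (s i).1)) (s i).2
      ≤ (1 - t) * ∑ i, hingeLoss (inner ℝ u (φ (s i).1)) (s i).2
        + t * ∑ i, hingeLoss (inner ℝ v (φ (s i).1)) (s i).2 := by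
    rw [Finset.mul_sum, Finset.mul_sum, ← Finset.sum_add_distrib]
    refine Finset.sum_le_sum fun i _ => ?_
    rw [inner_add_left, real_inner_smul_left, real_inner_smul_left]
    exact hingeLoss_convexComb_le _ _ _ h0 h1
  have hs' := mul_le_mul_of_nonneg_left hs (by positivity : (0 : ℝ) ≤ 1 / (n : ℝ))
  unfold svmObjective
  linear_combination hs' + l / 2 * hn

/-- The regularized objective grows quadratically around its minimizer. -/
theorem IsSVMSolution.add_sq_le {φ : X → H} {l : ℝ} {n : ℕ}
    {s : Fin n → X × Label} {w : H} (hw : IsSVMSolution φ l s w) (v : H) :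
    svmObjective φ l s w + l / 2 * ‖v - w‖ ^ 2 ≤ svmObjective φ l s v := by
  by_contra! hlt
  set A := l / 2 * ‖v - w‖ ^ 2 with hA
  set D := svmObjective φ l s v - svmObjective φ l s w with hD
  have hD0 : 0 ≤ D := sub_nonneg.2 (hw v)
  have hAD : D < A := by linarith
  have hA0 : 0 < A := hD0.trans_lt hAD
  -- Minimality and strong convexity force `(1 - t) A ≤ D` for every `t ∈ (0, 1]`. This `t` makes
  -- the left side `(A + D) / 2`, which exceeds `D`.
  set t := (A - D) / (2 * A) with ht
  have htA : t * (2 * A) = A - D := div_mul_cancel₀ _ (by positivity)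
  have h0 : 0 < t := div_pos (by linarith) (by linarith)
  have h1 : t ≤ 1 := (div_le_one (by linarith)).2 (by linarith)
  have h := (hw ((1 - t) • w + t • v)).trans
    (le_sub_iff_add_le.2 (svmObjective_convexComb_le φ l s w v h0.le h1))
  have h2 : t * ((1 - t) * A) ≤ t * D := by rw [hA, hD]; linarith
  have h3 := le_of_mul_le_mul_left h2 h0
  linarith

/-- Sum of the quadratic growth inequalities at the two minimizers. The terms are grouped so that
each bracket compares the two objectives at one and the same point, where the regularizer cancels.
-/
theorem IsSVMSolution.norm_sub_sq_le {X' : Type*} {φ : X → H} {φ' : X' → H} {l : ℝ} {n : ℕ}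
    {s : Fin n → X × Label} {s' : Fin n → X' × Label} {w w' : H} (hw : IsSVMSolution φ l s w)
    (hw' : IsSVMSolution φ' l s' w') :
    l * ‖w - w'‖ ^ 2 ≤ (svmObjective φ l s w' - svmObjective φ' l s' w')
      + (svmObjective φ' l s' w - svmObjective φ l s w) := by
  have h1 := hw.add_sq_le w'
  have h2 := hw'.add_sq_le w
  rw [norm_sub_rev] at h1
  linarith

/-- Replacing one example of the sample moves the SVM solution by at most `2 / (l * n)`. -/
theorem IsSVMSolution.norm_sub_le {φ : X → H} (hφ : ∀ x, ‖φ x‖ ≤ 1) {l : ℝ} (hl : 0 < l) {n : ℕ}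
    {s s' : Fin n → X × Label} {w w' : H} (hw : IsSVMSolution φ l s w)
    (hw' : IsSVMSolution φ l s' w') (k : Fin n) (hk : ∀ i, i ≠ k → s i = s' i) :
    ‖w - w'‖ ≤ 2 / (l * n) := by
  have hn : (0 : ℝ) < n := by exact_mod_cast k.pos
  have h := hw.norm_sub_sq_le hw'
  have hlip : ∀ (x : X) (y : Label) (u v : H),
      hingeLoss (inner ℝ u (φ x)) y - hingeLoss (inner ℝ v (φ x)) y ≤ ‖u - v‖ := by
    intro x y u v
    refine (hingeLoss_sub_le _ _ _).trans ?_
    rw [← inner_sub_left]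
    refine (abs_real_inner_le_norm _ _).trans ?_
    exact mul_le_of_le_one_right (norm_nonneg _) (hφ x)
  have hdiff : ∀ u : H, svmObjective φ l s u - svmObjective φ l s' u = 1 / (n : ℝ) *
      (hingeLoss (inner ℝ u (φ (s k).1)) (s k).2 - hingeLoss (inner ℝ u (φ (s' k).1)) (s' k).2) := by
    intro u
    unfold svmObjective
    rw [add_sub_add_left_eq_sub, ← mul_sub, ← Finset.sum_sub_distrib]
    congr 1
    refine Finset.sum_eq_single k (fun i _ hi => ?_) (by simp)
    rw [hk i hi, sub_self]
  -- Only the `k`-th hinge terms survive, one for the old example and one for the new. Each is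
  -- 1-Lipschitz in the weight vector because `‖φ x‖ ≤ 1`.
  have h2 : l * ‖w - w'‖ ^ 2 ≤ 1 / (n : ℝ) * (2 * ‖w - w'‖) := by
    have e1 := hlip (s k).1 (s k).2 w' w
    have e2 := hlip (s' k).1 (s' k).2 w w'
    rw [norm_sub_rev] at e1
    have e3 := hdiff w
    rw [← neg_sub, neg_eq_iff_eq_neg] at e3
    rw [hdiff w', e3, ← mul_neg, ← mul_add] at h
    exact h.trans (mul_le_mul_of_nonneg_left (by linarith) (by positivity))
  rcases (norm_nonneg (w - w')).eq_or_lt with h0 | h0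
  · rw [← h0]; positivity
  · rw [le_div_iff₀ (by positivity)]
    have h3 : ‖w - w'‖ * (‖w - w'‖ * (l * n)) ≤ ‖w - w'‖ * 2 := by
      have := mul_le_mul_of_nonneg_left h2 hn.le
      rw [← mul_assoc (n : ℝ) (1 / n), mul_one_div_cancel hn.ne'] at this
      linarith
    exact le_of_mul_le_mul_left h3 h0

/-- Comparison with the zero vector, whose objective is 1 (or 0 for an empty sample). -/
theorem IsSVMSolution.norm_sq_le {φ : X → H} {l : ℝ} (hl : 0 < l) {n : ℕ}
    {s : Fin n → X × Label} {w : H} (hw : IsSVMSolution φ l s w) : ‖w‖ ^ 2 ≤ 2 / l := by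
  have h := hw 0
  have h0 : svmObjective φ l s (0 : H) ≤ 1 := by
    unfold svmObjective hingeLoss
    simp only [norm_zero, inner_zero_left, mul_zero, sub_zero, ne_eq, OfNat.ofNat_ne_zero,
      not_false_eq_true, zero_pow, zero_le_one, sup_of_le_right, Finset.sum_const,
      Finset.card_univ, Fintype.card_fin, nsmul_eq_mul, mul_one, zero_add]
    rw [one_div]
    exact inv_mul_le_one
  have h1 : l / 2 * ‖w‖ ^ 2 ≤ svmObjective φ l s w := by
    unfold svmObjective hingeLoss
    have : 0 ≤ ∑ i, max 0 (1 - ((s i).2 : ℝ) * inner ℝ w (φ (s i).1)) :=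
      Finset.sum_nonneg fun i _ => le_max_left _ _
    exact le_add_of_nonneg_right (by positivity)
  rw [le_div_iff₀ hl]
  linarith

theorem svmObjective_sub_le {n : ℕ} (l : ℝ) (z z' : Fin n → H) (y : Fin n → Label) (w : H) :
    svmObjective id l (fun i => (z i, y i)) w - svmObjective id l (fun i => (z' i, y i)) w
      ≤ 1 / (n : ℝ) * ∑ i, ‖w‖ * ‖z i - z' i‖ := by
  unfold svmObjective
  rw [add_sub_add_left_eq_sub, ← mul_sub, ← Finset.sum_sub_distrib]
  refine mul_le_mul_of_nonneg_left (Finset.sum_le_sum fun i _ => ?_) (by positivity)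
  refine (hingeLoss_sub_le _ _ _).trans ?_
  rw [← inner_sub_right]
  exact abs_real_inner_le_norm _ _

/-- For fixed labels, objectives built on nearby feature vectors are close on bounded sets, and the
minimizers are uniformly bounded. This continuity is the source of measurability, which the
definition of `svm` by choice does not provide. -/
theorem continuous_svm_id [CompleteSpace H] {l : ℝ} (hl : 0 < l) {n : ℕ} (y : Fin n → Label) :
    Continuous fun z : Fin n → H => svm id l fun i => (z i, y i) := by
  refine continuous_iff_continuousAt.2 fun z₀ => ?_
  rw [ContinuousAt, tendsto_iff_norm_sub_tendsto_zero]
  set C := Real.sqrt (2 / l)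
  have hb : ∀ z : Fin n → H, ‖svm id l (fun i => (z i, y i))‖ ≤ C := fun z =>
    Real.le_sqrt_of_sq_le ((isSVMSolution_svm id hl _).norm_sq_le hl)
  have hlim : Tendsto (fun z : Fin n → H =>
      Real.sqrt ((1 / (n : ℝ) * ∑ i, C * ‖z i - z₀ i‖ + 1 / (n : ℝ) * ∑ i, C * ‖z₀ i - z i‖) / l))
      (𝓝 z₀) (𝓝 0) := by
    have hc : Continuous (fun z : Fin n → H =>
      Real.sqrt ((1 / (n : ℝ) * ∑ i, C * ‖z i - z₀ i‖
        + 1 / (n : ℝ) * ∑ i, C * ‖z₀ i - z i‖) / l)) := by fun_prop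
    simpa using hc.tendsto z₀
  refine squeeze_zero (fun _ => norm_nonneg _) (fun z => ?_) hlim
  refine Real.le_sqrt_of_sq_le ?_
  rw [le_div_iff₀ hl, mul_comm]
  refine ((isSVMSolution_svm id hl _).norm_sub_sq_le (isSVMSolution_svm id hl _)).trans ?_
  refine add_le_add ((svmObjective_sub_le l z z₀ y _).trans ?_)
    ((svmObjective_sub_le l z₀ z y _).trans ?_) <;>
  · refine mul_le_mul_of_nonneg_left (Finset.sum_le_sum fun i _ => ?_) (by positivity)
    exact mul_le_mul_of_nonneg_right (hb _) (norm_nonneg _)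

/-- The hinge loss sees an example only through `y • φ x`, so the labels can be absorbed into the
features and frozen at 1. -/
theorem svm_eq_svm_id [CompleteSpace H] (φ : X → H) {l : ℝ} (hl : 0 < l) {n : ℕ}
    (s : Fin n → X × Label) :
    svm φ l s = svm id l fun i => (((s i).2 : ℝ) • φ (s i).1, (⟨1, by simp⟩ : Label)) := by
  refine (existsUnique_isSVMSolution φ hl s).unique (isSVMSolution_svm φ hl s) ?_
  have h := isSVMSolution_svm id hl
    fun i => (((s i).2 : ℝ) • φ (s i).1, (⟨1, by simp⟩ : Label))
  have heq : ∀ w : H, svmObjective φ l s w = svmObjective id l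
      (fun i => (((s i).2 : ℝ) • φ (s i).1, (⟨1, by simp⟩ : Label))) w := by
    intro w
    simp [svmObjective, hingeLoss, real_inner_smul_right]
  intro w'
  rw [heq, heq]
  exact h w'

theorem measurable_svm [MeasurableSpace X] [CompleteSpace H] [TopologicalSpace.SeparableSpace H]
    [MeasurableSpace H] [BorelSpace H] {φ : X → H} (hφ : Measurable φ) {l : ℝ} (hl : 0 < l)
    (n : ℕ) : Measurable fun s : Fin n → X × Label => svm φ l s := by
  have := UniformSpace.secondCountable_of_separable H
  simp_rw [svm_eq_svm_id φ hl]
  refine (continuous_svm_id hl _).measurable.comp (measurable_pi_lambda _ fun i => ?_)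
  have h1 : Measurable fun s : Fin n → X × Label => ((s i).2 : ℝ) :=
    measurable_subtype_coe.comp (measurable_snd.comp (measurable_pi_apply i))
  exact h1.smul (hφ.comp (measurable_fst.comp (measurable_pi_apply i)))

end SVMStability

end PacBayesSVM

namespace PacBayesSVM

/-! ### Concentration of scalar and Hilbert-valued functions with bounded differences. -/

section BoundedDifferences

variable {α : Type*}

/-- Changing one coordinate changes the value of `f` by at most `c`. -/
def HasBoundedDifferences {E : Type*} [NormedAddCommGroup E] {n : ℕ} (c : ℝ)
    (f : (Fin n → α) → E) : Prop :=
  ∀ (k : Fin n) (s s' : Fin n → α), (∀ i, i ≠ k → s i = s' i) → ‖f s - f s'‖ ≤ c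

theorem HasBoundedDifferences.cons {E : Type*} [NormedAddCommGroup E] {n : ℕ} {c : ℝ}
    {f : (Fin (n + 1) → α) → E} (h : HasBoundedDifferences c f) (x : α) :
    HasBoundedDifferences c fun s : Fin n → α => f (Fin.cons x s) := by
  intro k s s' hs
  refine h k.succ _ _ fun i hi => ?_
  induction i using Fin.cases with
  | zero => simp
  | succ i =>
    simp only [Fin.cons_succ]
    exact hs i fun h => hi (h ▸ rfl)

theorem HasBoundedDifferences.norm_cons_sub_le {E : Type*} [NormedAddCommGroup E] {n : ℕ} {c : ℝ}
    {f : (Fin (n + 1) → α) → E} (h : HasBoundedDifferences c f) (x x' : α) (s : Fin n → α) :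
    ‖f (Fin.cons x s) - f (Fin.cons x' s)‖ ≤ c := by
  refine h 0 _ _ fun i hi => ?_
  induction i using Fin.cases with
  | zero => exact absurd rfl hi
  | succ i => simp

theorem HasBoundedDifferences.norm_sub_const {E : Type*} [NormedAddCommGroup E] {n : ℕ} {c : ℝ}
    {f : (Fin n → α) → E} (h : HasBoundedDifferences c f) (a : E) :
    HasBoundedDifferences c fun s => ‖f s - a‖ := by
  intro k s s' hs
  refine (abs_norm_sub_norm_le _ _).trans ?_
  rw [sub_sub_sub_cancel_right]
  exact h k s s' hs

variable [MeasurableSpace α]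

theorem measurePreserving_finCons (μ : Measure α) [SigmaFinite μ] (n : ℕ) :
    MeasurePreserving (fun p : α × (Fin n → α) => (Fin.cons p.1 p.2 : Fin (n + 1) → α))
      (μ.prod (Measure.pi fun _ => μ)) (Measure.pi fun _ => μ) := by
  have h := (measurePreserving_piFinSuccAbove (fun _ : Fin (n + 1) => μ) 0).symm
  refine ⟨?_, ?_⟩
  · convert! h.measurable using 1
    ext p
    simp [MeasurableEquiv.piFinSuccAbove_symm_apply, Fin.insertNthEquiv]
  · convert! h.map_eq using 2
    ext p
    simp [MeasurableEquiv.piFinSuccAbove_symm_apply, Fin.insertNthEquiv]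

theorem integral_pi_finCons {E : Type*} [NormedAddCommGroup E] [NormedSpace ℝ E] (μ : Measure α)
    [IsProbabilityMeasure μ] {n : ℕ} {f : (Fin (n + 1) → α) → E}
    (hf : Integrable f (Measure.pi fun _ => μ)) :
    ∫ s, f s ∂(Measure.pi fun _ => μ)
      = ∫ x, ∫ s, f (Fin.cons x s) ∂(Measure.pi fun _ : Fin n => μ) ∂μ := by
  have h := measurePreserving_finCons μ n
  rw [← h.map_eq, integral_map h.measurable.aemeasurable (by rw [h.map_eq]; exact hf.1),
    integral_prod (fun p : α × (Fin n → α) => f (Fin.cons p.1 p.2))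
      (h.integrable_comp_of_integrable hf)]

theorem integrable_of_measurable_of_norm_le {Ω E : Type*} [MeasurableSpace Ω]
    [NormedAddCommGroup E] (μ : Measure Ω) [IsFiniteMeasure μ] {f : Ω → E}
    (hf : StronglyMeasurable f) {M : ℝ} (hM : ∀ x, ‖f x‖ ≤ M) : Integrable f μ :=
  Integrable.of_bound hf.aestronglyMeasurable M (ae_of_all _ hM)

theorem HasBoundedDifferences.norm_integral_cons_sub_le {E : Type*} [NormedAddCommGroup E]
    [NormedSpace ℝ E] {n : ℕ} {c M : ℝ} {f : (Fin (n + 1) → α) → E}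
    (h : HasBoundedDifferences c f) (hf : StronglyMeasurable f) (hM : ∀ s, ‖f s‖ ≤ M)
    (μ : Measure α) [IsProbabilityMeasure μ] (x x' : α) :
    ‖∫ s, f (Fin.cons x s) ∂(Measure.pi fun _ : Fin n => μ)
      - ∫ s, f (Fin.cons x' s) ∂(Measure.pi fun _ : Fin n => μ)‖ ≤ c := by
  have hm := (measurePreserving_finCons μ n).measurable
  have hi : ∀ x, Integrable (fun s : Fin n → α => f (Fin.cons x s)) (Measure.pi fun _ => μ) :=
    fun x => integrable_of_measurable_of_norm_le _
      (hf.comp_measurable (hm.comp measurable_prodMk_left)) fun s => hM _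
  rw [← integral_sub (hi x) (hi x')]
  refine (norm_integral_le_of_norm_le_const
    (ae_of_all _ fun s => h.norm_cons_sub_le x x' s)).trans ?_
  simp

/-- The exponential moment bound behind McDiarmid's inequality. -/
theorem HasBoundedDifferences.integral_exp_le (μ : Measure α) [IsProbabilityMeasure μ] {c M : ℝ}
    (t : ℝ) {n : ℕ} {f : (Fin n → α) → ℝ} (h : HasBoundedDifferences c f) (hf : Measurable f)
    (hM : ∀ s, ‖f s‖ ≤ M) :
    ∫ s, Real.exp (t * (f s - ∫ s, f s ∂(Measure.pi fun _ => μ))) ∂(Measure.pi fun _ => μ)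
      ≤ Real.exp (n * c ^ 2 / 4 * t ^ 2 / 2) := by
  induction n with
  | zero =>
    have : ∀ s, f s = f default := fun s => congrArg f (Subsingleton.elim _ _)
    simp [this]
  | succ n ih =>
    have hm := (measurePreserving_finCons μ n).measurable
    have hfc : Measurable fun p : α × (Fin n → α) => f (Fin.cons p.1 p.2) := hf.comp hm
    -- The conditional expectation given the first coordinate. The deviation splits as `(f - g x) +
    -- (g x - E g)`: induction handles the first term for each fixed `x`, Hoeffding's lemma the
    -- second.
    set g : α → ℝ := fun x => ∫ s, f (Fin.cons x s) ∂(Measure.pi fun _ : Fin n => μ) with hg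
    have hgm : Measurable g := (hfc.stronglyMeasurable.integral_prod_right').measurable
    have hgM : ∀ x, ‖g x‖ ≤ M := fun x => by
      refine (norm_integral_le_of_norm_le_const (ae_of_all _ fun s => hM _)).trans ?_
      simp
    have hEf : ∫ s, f s ∂(Measure.pi fun _ => μ) = ∫ x, g x ∂μ :=
      integral_pi_finCons μ (integrable_of_measurable_of_norm_le _ hf.stronglyMeasurable hM)
    have hexp_bound : ∀ (a b m : ℝ), |a| ≤ m → |b| ≤ m →
        ‖Real.exp (t * (a - b))‖ ≤ Real.exp (|t| * (m + m)) := by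
      intro a b m ha hb
      rw [Real.norm_eq_abs, Real.abs_exp, Real.exp_le_exp]
      refine (le_abs_self _).trans ?_
      rw [abs_mul]
      exact mul_le_mul_of_nonneg_left ((abs_sub _ _).trans (add_le_add ha hb)) (abs_nonneg _)
    have hEg : |∫ x, g x ∂μ| ≤ M := by
      refine (norm_integral_le_of_norm_le_const (ae_of_all _ hgM)).trans ?_
      simp
    obtain ⟨x₀⟩ : Nonempty α := nonempty_of_isProbabilityMeasure μ
    have hbdd : BddBelow (Set.range g) :=
      ⟨-M, by rintro _ ⟨x, rfl⟩; exact (abs_le.1 (hgM x)).1⟩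
    have hosc : ∀ x x', g x - g x' ≤ c := fun x x' =>
      (le_abs_self _).trans (h.norm_integral_cons_sub_le hf.stronglyMeasurable hM μ x x')
    have hc0 : 0 ≤ c := by simpa using hosc x₀ x₀
    have : Nonempty α := ⟨x₀⟩
    -- An oscillation of at most `c` puts `g` in an interval of length `c`, so Hoeffding's lemma
    -- contributes the variance proxy `c² / 4`.
    have hIcc : ∀ x, g x ∈ Set.Icc (⨅ x, g x) ((⨅ x, g x) + c) := fun x =>
      ⟨ciInf_le hbdd x, by
        rw [← sub_le_iff_le_add]
        exact le_ciInf fun x' => by linarith [hosc x x']⟩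
    have hH := (hasSubgaussianMGF_of_mem_Icc (μ := μ) hgm.aemeasurable (ae_of_all _ hIcc)).mgf_le t
    rw [hEf, integral_pi_finCons μ]
    · calc
        ∫ x, ∫ s, Real.exp (t * (f (Fin.cons x s) - ∫ x, g x ∂μ)) ∂(Measure.pi fun _ => μ) ∂μ
          = ∫ x, (∫ s, Real.exp (t * (f (Fin.cons x s) - g x)) ∂(Measure.pi fun _ => μ))
              * Real.exp (t * (g x - ∫ x, g x ∂μ)) ∂μ := by
            refine integral_congr_ae (ae_of_all _ fun x => ?_)
            simp only
            rw [← integral_mul_const]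
            refine integral_congr_ae (ae_of_all _ fun s => ?_)
            simp only
            rw [← Real.exp_add]
            ring_nf
        _ ≤ ∫ x, Real.exp (n * c ^ 2 / 4 * t ^ 2 / 2)
              * Real.exp (t * (g x - ∫ x, g x ∂μ)) ∂μ := by
            refine integral_mono_of_nonneg (ae_of_all _ fun x => ?_) ?_ (ae_of_all _ fun x => ?_)
            · exact mul_nonneg (integral_nonneg fun s => (Real.exp_pos _).le) (Real.exp_pos _).le
            · refine Integrable.const_mul ?_ _
              exact integrable_of_measurable_of_norm_le _
                ((hgm.sub_const _).const_mul t).exp.stronglyMeasurable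
                fun x => hexp_bound _ _ M (hgM x) hEg
            · refine mul_le_mul_of_nonneg_right ?_ (Real.exp_pos _).le
              exact ih (h.cons x) (hfc.comp measurable_prodMk_left) fun s => hM _
        _ ≤ Real.exp (n * c ^ 2 / 4 * t ^ 2 / 2) * Real.exp (c ^ 2 / 4 * t ^ 2 / 2) := by
            rw [integral_const_mul]
            refine mul_le_mul_of_nonneg_left ?_ (Real.exp_pos _).le
            refine (le_of_eq ?_).trans (hH.trans (le_of_eq ?_))
            · rfl
            · congr 3
              rw [add_sub_cancel_left]
              push_cast
              rw [Real.norm_eq_abs, abs_of_nonneg hc0]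
              ring
        _ = _ := by
            rw [← Real.exp_add]
            push_cast
            ring_nf
    · refine integrable_of_measurable_of_norm_le _
        ((hf.sub_const _).const_mul t).exp.stronglyMeasurable
        fun x => hexp_bound _ _ M (hM x) hEg

/-- **McDiarmid's bounded difference inequality.** -/
theorem HasBoundedDifferences.measure_ge_le (μ : Measure α) [IsProbabilityMeasure μ] {c M : ℝ}
    {n : ℕ} {f : (Fin n → α) → ℝ} (h : HasBoundedDifferences c f) (hf : Measurable f)
    (hM : ∀ s, ‖f s‖ ≤ M) {ε : ℝ} (hε : 0 ≤ ε) :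
    (Measure.pi fun _ : Fin n => μ).real
        {s | ε ≤ f s - ∫ s, f s ∂(Measure.pi fun _ : Fin n => μ)}
      ≤ Real.exp (-ε ^ 2 / (2 * (n * c ^ 2 / 4))) := by
  have hsub : HasSubgaussianMGF (fun s => f s - ∫ s, f s ∂(Measure.pi fun _ : Fin n => μ))
      (n * c ^ 2 / 4).toNNReal (Measure.pi fun _ : Fin n => μ) := by
    have hc : (((n * c ^ 2 / 4).toNNReal : ℝ≥0) : ℝ) = n * c ^ 2 / 4 :=
      Real.coe_toNNReal _ (by positivity)
    refine ⟨fun t => ?_, fun t => ?_⟩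
    · refine integrable_exp_mul_of_mem_Icc (a := -(M + M)) (b := M + M)
        (hf.sub_const _).aemeasurable (ae_of_all _ fun s => ?_)
      rw [Set.mem_Icc, ← abs_le]
      refine (abs_sub _ _).trans (add_le_add (hM s) ?_)
      refine (norm_integral_le_of_norm_le_const (ae_of_all _ hM)).trans ?_
      simp
    · rw [hc]
      exact h.integral_exp_le μ t hf hM
  have := hsub.measure_ge_le hε
  rwa [Real.coe_toNNReal _ (by positivity)] at this

/-- The increments of the martingale that reveals one coordinate at a time are orthogonal, and each
has norm at most `c`, so their squared norms add up. -/
theorem HasBoundedDifferences.integral_norm_sub_sq_le {E : Type*} [NormedAddCommGroup E]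
    [InnerProductSpace ℝ E] [CompleteSpace E] (μ : Measure α) [IsProbabilityMeasure μ] {c M : ℝ}
    {n : ℕ} {f : (Fin n → α) → E} (h : HasBoundedDifferences c f) (hf : StronglyMeasurable f)
    (hM : ∀ s, ‖f s‖ ≤ M) :
    ∫ s, ‖f s - ∫ s, f s ∂(Measure.pi fun _ : Fin n => μ)‖ ^ 2 ∂(Measure.pi fun _ : Fin n => μ)
      ≤ n * c ^ 2 := by
  induction n with
  | zero =>
    have : ∀ s, f s = f default := fun s => congrArg f (Subsingleton.elim _ _)
    simp [this]
  | succ n ih =>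
    have hm := (measurePreserving_finCons μ n).measurable
    have hfc : StronglyMeasurable fun p : α × (Fin n → α) => f (Fin.cons p.1 p.2) :=
      hf.comp_measurable hm
    set g : α → E := fun x => ∫ s, f (Fin.cons x s) ∂(Measure.pi fun _ : Fin n => μ) with hg
    have hgm : StronglyMeasurable g := hfc.integral_prod_right'
    have hgM : ∀ x, ‖g x‖ ≤ M := fun x => by
      refine (norm_integral_le_of_norm_le_const (ae_of_all _ fun s => hM _)).trans ?_
      simp
    have hgi : Integrable g μ := integrable_of_measurable_of_norm_le _ hgm hgM
    have hEf : ∫ s, f s ∂(Measure.pi fun _ => μ) = ∫ x, g x ∂μ :=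
      integral_pi_finCons μ (integrable_of_measurable_of_norm_le _ hf hM)
    have hEg : ‖∫ x, g x ∂μ‖ ≤ M := by
      refine (norm_integral_le_of_norm_le_const (ae_of_all _ hgM)).trans ?_
      simp
    have hdev : ∀ x, ‖g x - ∫ x, g x ∂μ‖ ≤ c := fun x => by
      have : g x - ∫ x, g x ∂μ = ∫ x', (g x - g x') ∂μ := by
        rw [integral_sub (integrable_const _) hgi]
        simp
      rw [this]
      refine (norm_integral_le_of_norm_le_const (ae_of_all _ fun x' =>
        h.norm_integral_cons_sub_le hf hM μ x x')).trans ?_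
      simp
    have hsq : ∀ {Ω : Type _} [MeasurableSpace Ω] (ν : Measure Ω) [IsProbabilityMeasure ν]
        (F : Ω → E) (a : E), StronglyMeasurable F → (∀ s, ‖F s‖ ≤ M) →
        Integrable (fun s => ‖F s - a‖ ^ 2) ν := by
      intro Ω _ ν _ F a hF hFM
      refine integrable_of_measurable_of_norm_le (M := (M + ‖a‖) ^ 2) _
        ((hF.sub stronglyMeasurable_const).norm.pow 2) fun s => ?_
      rw [norm_pow, norm_norm]
      exact pow_le_pow_left₀ (norm_nonneg _)
        ((norm_sub_le _ _).trans (add_le_add_left (hFM s) _)) 2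
    have hin : ∀ x, ∫ s, ‖f (Fin.cons x s) - ∫ x, g x ∂μ‖ ^ 2 ∂(Measure.pi fun _ : Fin n => μ)
        ≤ n * c ^ 2 + c ^ 2 := by
      intro x
      have hFm : StronglyMeasurable fun s : Fin n → α => f (Fin.cons x s) :=
        hfc.comp_measurable measurable_prodMk_left
      have hFi : Integrable (fun s : Fin n → α => f (Fin.cons x s)) (Measure.pi fun _ => μ) :=
        integrable_of_measurable_of_norm_le _ hFm fun s => hM _
      -- Given the first coordinate, `f - g x` has mean zero while the other factor is constant.
      have hcross : ∫ s, inner ℝ (g x - ∫ x, g x ∂μ) (f (Fin.cons x s) - g x)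
          ∂(Measure.pi fun _ : Fin n => μ) = 0 := by
        have hi : Integrable (fun s : Fin n → α => f (Fin.cons x s) - g x)
            (Measure.pi fun _ => μ) := hFi.sub (integrable_const _)
        rw [integral_inner hi, integral_sub hFi (integrable_const _)]
        simp [hg]
      calc
        ∫ s, ‖f (Fin.cons x s) - ∫ x, g x ∂μ‖ ^ 2 ∂(Measure.pi fun _ : Fin n => μ)
          = ∫ s, (‖f (Fin.cons x s) - g x‖ ^ 2 + (2 * inner ℝ (g x - ∫ x, g x ∂μ)
              (f (Fin.cons x s) - g x) + ‖g x - ∫ x, g x ∂μ‖ ^ 2))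
              ∂(Measure.pi fun _ : Fin n => μ) := by
            refine integral_congr_ae (ae_of_all _ fun s => ?_)
            simp only
            rw [← sub_add_sub_cancel (f (Fin.cons x s)) (g x), norm_add_sq_real, real_inner_comm]
            ring
        _ = ∫ s, ‖f (Fin.cons x s) - g x‖ ^ 2 ∂(Measure.pi fun _ : Fin n => μ)
              + ‖g x - ∫ x, g x ∂μ‖ ^ 2 := by
            have hi2 : Integrable (fun s : Fin n → α => 2 * inner ℝ (g x - ∫ x, g x ∂μ)
                (f (Fin.cons x s) - g x)) (Measure.pi fun _ => μ) :=
              ((hFi.sub (integrable_const _)).const_inner _).const_mul 2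
            have hi3 : Integrable (fun s : Fin n → α => 2 * inner ℝ (g x - ∫ x, g x ∂μ)
                (f (Fin.cons x s) - g x) + ‖g x - ∫ x, g x ∂μ‖ ^ 2) (Measure.pi fun _ => μ) :=
              hi2.add (integrable_const _)
            rw [integral_add (hsq _ _ _ hFm fun s => hM _) hi3,
              integral_add hi2 (integrable_const _), integral_const_mul, hcross]
            simp
        _ ≤ n * c ^ 2 + c ^ 2 := by
            refine add_le_add ?_ (pow_le_pow_left₀ (norm_nonneg _) (hdev x) 2)
            exact ih (h.cons x) hFm fun s => hM _
    rw [hEf, integral_pi_finCons μ (hsq _ _ _ hf hM)]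
    refine (integral_mono_of_nonneg (ae_of_all _ fun x => integral_nonneg fun s => by positivity)
      (integrable_const _) (ae_of_all _ hin)).trans (le_of_eq ?_)
    simp
    ring

/-- Concentration of a Hilbert space valued function with bounded differences around its mean. -/
theorem HasBoundedDifferences.measure_norm_sub_ge_le {E : Type*} [NormedAddCommGroup E]
    [InnerProductSpace ℝ E] [CompleteSpace E] (μ : Measure α) [IsProbabilityMeasure μ] {c M : ℝ}
    (hc : 0 < c) {n : ℕ} (hn : 1 ≤ n) {f : (Fin n → α) → E} (h : HasBoundedDifferences c f)
    (hf : StronglyMeasurable f) (hM : ∀ s, ‖f s‖ ≤ M) {δ : ℝ} (hδ : δ ∈ Set.Ioo (0 : ℝ) 1) :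
    (Measure.pi fun _ : Fin n => μ).real
        {s | c * Real.sqrt n * (1 + Real.sqrt (1 / 2 * Real.log (1 / δ)))
          ≤ ‖f s - ∫ s, f s ∂(Measure.pi fun _ : Fin n => μ)‖} ≤ δ := by
  set m := ∫ s, f s ∂(Measure.pi fun _ : Fin n => μ) with hm
  set F : (Fin n → α) → ℝ := fun s => ‖f s - m‖ with hF
  have hn' : (0 : ℝ) < n := by exact_mod_cast hn
  have hFm : StronglyMeasurable F := (hf.sub stronglyMeasurable_const).norm
  have hFM : ∀ s, ‖F s‖ ≤ M + ‖m‖ := fun s => by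
    rw [hF, norm_norm]
    exact (norm_sub_le _ _).trans (add_le_add_left (hM s) _)
  have hL : 0 ≤ 1 / 2 * Real.log (1 / δ) :=
    mul_nonneg (by norm_num) (Real.log_nonneg (by rw [le_div_iff₀ hδ.1]; linarith [hδ.2]))
  -- The first moment is bounded by the root of the second moment, through nonnegativity of the
  -- variance of `F`.
  have hEF : ∫ s, F s ∂(Measure.pi fun _ : Fin n => μ) ≤ c * Real.sqrt n := by
    have h1 := h.integral_norm_sub_sq_le μ hf hM
    have hint : Integrable F (Measure.pi fun _ : Fin n => μ) :=
      integrable_of_measurable_of_norm_le _ hFm hFM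
    have hint2 : Integrable (fun s => F s ^ 2) (Measure.pi fun _ : Fin n => μ) := by
      refine integrable_of_measurable_of_norm_le (M := (M + ‖m‖) ^ 2) _ (hFm.pow 2) fun s => ?_
      rw [norm_pow]
      exact pow_le_pow_left₀ (norm_nonneg _) (hFM s) 2
    set a := ∫ s, F s ∂(Measure.pi fun _ : Fin n => μ) with ha
    have h2 : 0 ≤ ∫ s, (F s - a) ^ 2 ∂(Measure.pi fun _ : Fin n => μ) :=
      integral_nonneg fun s => sq_nonneg _
    have h3 : ∫ s, (F s - a) ^ 2 ∂(Measure.pi fun _ : Fin n => μ)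
        = ∫ s, F s ^ 2 ∂(Measure.pi fun _ : Fin n => μ) - a ^ 2 := by
      calc
        _ = ∫ s, (F s ^ 2 - (2 * a * F s - a ^ 2)) ∂(Measure.pi fun _ : Fin n => μ) := by
          refine integral_congr_ae (ae_of_all _ fun s => ?_)
          simp only
          ring
        _ = _ := by
          have hint3 : Integrable (fun s => 2 * a * F s - a ^ 2) (Measure.pi fun _ : Fin n => μ) :=
            (hint.const_mul _).sub (integrable_const _)
          rw [integral_sub hint2 hint3,
            integral_sub (hint.const_mul _) (integrable_const _), integral_const_mul, ← ha]
          simp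
          ring
    refine abs_le_of_sq_le_sq' ?_ (by positivity) |>.2
    rw [mul_pow, Real.sq_sqrt hn'.le]
    linarith
  have hmc := (h.norm_sub_const m).measure_ge_le μ hFm.measurable hFM
    (ε := c * Real.sqrt n * Real.sqrt (1 / 2 * Real.log (1 / δ))) (by positivity)
  -- The deviation is chosen so that McDiarmid's exponent `-2 ε² / (n c²)` equals `log δ`.
  have hval : Real.exp (-(c * Real.sqrt n * Real.sqrt (1 / 2 * Real.log (1 / δ))) ^ 2
      / (2 * (n * c ^ 2 / 4))) = δ := by
    rw [mul_pow, mul_pow, Real.sq_sqrt hn'.le, Real.sq_sqrt hL]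
    have : -(c ^ 2 * n * (1 / 2 * Real.log (1 / δ))) / (2 * (n * c ^ 2 / 4)) = Real.log δ := by
      rw [one_div δ, Real.log_inv]
      field_simp
      ring
    rw [this, Real.exp_log hδ.1]
  rw [hval] at hmc
  refine (measureReal_mono fun s hs => ?_).trans hmc
  simp only [Set.mem_ofPred_eq] at hs ⊢
  have : F s = ‖f s - m‖ := rfl
  linarith

end BoundedDifferences

end PacBayesSVM

namespace PacBayesSVM

/-! ### Relative entropy in dual form, for Gaussian product measures. -/

section DonskerVaradhan

/-- The inequality `∫ f dQ ≤ K + log ∫ exp f dP` for all bounded measurable `f`; by the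
Donsker-Varadhan formula it says that the relative entropy of `Q` with respect to `P` is at
most `K`. -/
def RelEntropyLE {Ω : Type*} [MeasurableSpace Ω] (K : ℝ) (Q P : Measure Ω) : Prop :=
  ∀ f : Ω → ℝ, Measurable f → (∃ C, ∀ x, |f x| ≤ C) →
    ∫ x, f x ∂Q ≤ K + Real.log (∫ x, Real.exp (f x) ∂P)

theorem integrable_exp_of_abs_le {Ω : Type*} [MeasurableSpace Ω] (P : Measure Ω)
    [IsFiniteMeasure P] {f : Ω → ℝ} (hf : Measurable f) {C : ℝ} (hC : ∀ x, |f x| ≤ C) :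
    Integrable (fun x => Real.exp (f x)) P :=
  integrable_of_measurable_of_norm_le P hf.exp.stronglyMeasurable (M := Real.exp C) fun x => by
    rw [Real.norm_eq_abs, Real.abs_exp, Real.exp_le_exp]
    exact (le_abs_self _).trans (hC x)

/-- Jensen's inequality for `exp` under `Q`, applied to `f - L`. The density `exp L` cancels,
leaving `∫ exp f dP`. -/
theorem relEntropyLE_of_withDensity {Ω : Type*} [MeasurableSpace Ω] {P Q : Measure Ω}
    [IsProbabilityMeasure P] [IsProbabilityMeasure Q] {L : Ω → ℝ} (hL : Measurable L)
    (hQ : Q = P.withDensity fun x => ENNReal.ofReal (Real.exp (L x))) (hLi : Integrable L Q)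
    {K : ℝ} (hK : ∫ x, L x ∂Q ≤ K) : RelEntropyLE K Q P := by
  rintro f hf ⟨C, hC⟩
  have hfi : Integrable f Q := integrable_of_measurable_of_norm_le Q hf.stronglyMeasurable hC
  have hexp : Integrable (fun x => Real.exp (f x)) P := integrable_exp_of_abs_le P hf hC
  have hdens : Measurable fun x => ENNReal.ofReal (Real.exp (L x)) := hL.exp.ennreal_ofReal
  have hmul : ∀ x, (ENNReal.ofReal (Real.exp (L x))).toReal • Real.exp (f x - L x)
      = Real.exp (f x) := fun x => by
    rw [ENNReal.toReal_ofReal (Real.exp_pos _).le, smul_eq_mul, ← Real.exp_add]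
    ring_nf
  have hi : Integrable (fun x => Real.exp (f x - L x)) Q := by
    rw [hQ, integrable_withDensity_iff_integrable_smul' hdens
      (ae_of_all _ fun x => ENNReal.ofReal_lt_top)]
    simpa only [hmul] using hexp
  have heq : ∫ x, Real.exp (f x - L x) ∂Q = ∫ x, Real.exp (f x) ∂P := by
    rw [hQ, integral_withDensity_eq_integral_toReal_smul hdens
      (ae_of_all _ fun x => ENNReal.ofReal_lt_top)]
    simp only [hmul]
  have hJ := convexOn_exp.map_integral_le Real.continuous_exp.continuousOn isClosed_univ
    (ae_of_all Q fun x => Set.mem_univ (f x - L x)) (hfi.sub hLi) hi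
  rw [heq, integral_sub hfi hLi] at hJ
  have hlog := (Real.le_log_iff_exp_le ((Real.exp_pos _).trans_le hJ)).2 hJ
  linarith

theorem lintegral_pi_prod {ι : Type*} [Fintype ι] {X : ι → Type*} [∀ i, MeasurableSpace (X i)]
    (μ : ∀ i, Measure (X i)) [∀ i, IsProbabilityMeasure (μ i)] {g : ∀ i, X i → ℝ≥0∞}
    (hg : ∀ i, Measurable (g i)) :
    ∫⁻ x, ∏ i, g i (x i) ∂(Measure.pi μ) = ∏ i, ∫⁻ x, g i x ∂(μ i) := by
  have hind : iIndepFun (fun i (x : ∀ i, X i) => g i (x i)) (Measure.pi μ) :=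
    iIndepFun_pi fun i => (hg i).aemeasurable
  have h := lintegral_prod_eq_prod_lintegral_of_indepFun Finset.univ _ hind
    fun i => (hg i).comp (measurable_pi_apply i)
  rw [h]
  refine Finset.prod_congr rfl fun i _ => ?_
  exact (measurePreserving_eval μ i).lintegral_comp (hg i)

theorem pi_withDensity {ι : Type*} [Fintype ι] {X : ι → Type*} [∀ i, MeasurableSpace (X i)]
    (P Q : ∀ i, Measure (X i)) [∀ i, IsProbabilityMeasure (P i)] [∀ i, IsProbabilityMeasure (Q i)]
    {g : ∀ i, X i → ℝ≥0∞} (hg : ∀ i, Measurable (g i)) (hQ : ∀ i, Q i = (P i).withDensity (g i)) :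
    Measure.pi Q = (Measure.pi P).withDensity fun x => ∏ i, g i (x i) := by
  classical
  refine Measure.pi_eq fun s hs => ?_
  have hbox : MeasurableSet (Set.univ.pi s) := MeasurableSet.univ_pi hs
  rw [withDensity_apply _ hbox, ← lintegral_indicator hbox]
  have hind : ∀ x, (Set.univ.pi s).indicator (fun x => ∏ i, g i (x i)) x
      = ∏ i, (s i).indicator (g i) (x i) := by
    intro x
    by_cases hx : x ∈ Set.univ.pi s
    · rw [Set.indicator_of_mem hx]
      exact Finset.prod_congr rfl fun i _ => (Set.indicator_of_mem (hx i trivial) _).symm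
    · rw [Set.indicator_of_notMem hx]
      simp only [Set.mem_pi, Set.mem_univ, true_implies, not_forall] at hx
      obtain ⟨i, hi⟩ := hx
      exact (Finset.prod_eq_zero (Finset.mem_univ i) (Set.indicator_of_notMem hi _)).symm
  simp only [hind]
  rw [lintegral_pi_prod P fun i => (hg i).indicator (hs i)]
  refine Finset.prod_congr rfl fun i _ => ?_
  rw [lintegral_indicator (hs i), hQ i, withDensity_apply _ (hs i)]

theorem gaussianReal_eq_withDensity (m m' : ℝ) {v : ℝ≥0} (hv : v ≠ 0) :
    gaussianReal m' v = (gaussianReal m v).withDensity fun x =>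
      ENNReal.ofReal (Real.exp ((m' - m) * (x - m) / v - (m' - m) ^ 2 / (2 * v))) := by
  rw [gaussianReal_of_var_ne_zero _ hv, gaussianReal_of_var_ne_zero _ hv,
    ← withDensity_mul _ (measurable_gaussianPDF m v) (by fun_prop)]
  congr 1
  ext x
  have hv' : (v : ℝ) ≠ 0 := by exact_mod_cast hv
  rw [Pi.mul_apply, gaussianPDF_def, gaussianPDF_def,
    ← ENNReal.ofReal_mul (gaussianPDFReal_nonneg _ _ _), gaussianPDFReal_def,
    gaussianPDFReal_def]
  simp only
  rw [mul_assoc _ (Real.exp _) (Real.exp _), ← Real.exp_add]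
  congr 3
  field_simp
  ring

/-- The log-density ratio is a sum of affine functions of single coordinates, so its mean under the
first measure needs only the Gaussian means. -/
theorem relEntropyLE_pi_gaussianReal {ι : Type*} [Fintype ι] (m m' : ι → ℝ) {v : ℝ≥0}
    (hv : v ≠ 0) : RelEntropyLE (∑ i, (m' i - m i) ^ 2 / (2 * v))
      (Measure.pi fun i => gaussianReal (m' i) v) (Measure.pi fun i => gaussianReal (m i) v) := by
  have hv' : (v : ℝ) ≠ 0 := by exact_mod_cast hv
  have hi : ∀ i, Integrable (fun x : ℝ => (m' i - m i) * (x - m i) / v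
      - (m' i - m i) ^ 2 / (2 * v)) (gaussianReal (m' i) v) := by
    intro i
    have hid : Integrable (fun x : ℝ => x) (gaussianReal (m' i) v) :=
      (memLp_id_gaussianReal 1).integrable le_rfl
    exact (((hid.sub (integrable_const _)).const_mul _).div_const _).sub (integrable_const _)
  have hint : ∀ i, ∫ x : ℝ, ((m' i - m i) * (x - m i) / v - (m' i - m i) ^ 2 / (2 * v))
      ∂(gaussianReal (m' i) v) = (m' i - m i) ^ 2 / (2 * v) := by
    intro i
    have hid : Integrable (fun x : ℝ => x) (gaussianReal (m' i) v) :=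
      (memLp_id_gaussianReal 1).integrable le_rfl
    have hid2 : Integrable (fun x : ℝ => (m' i - m i) * (x - m i) / v) (gaussianReal (m' i) v) :=
      ((hid.sub (integrable_const _)).const_mul _).div_const _
    rw [integral_sub hid2 (integrable_const _), integral_div, integral_const_mul,
      integral_sub hid (integrable_const _), integral_id_gaussianReal]
    simp
    field_simp
    ring
  have hev : ∀ i, MeasurePreserving (Function.eval i)
      (Measure.pi fun i => gaussianReal (m' i) v) (gaussianReal (m' i) v) :=
    fun i => measurePreserving_eval (fun i => gaussianReal (m' i) v) i
  have hi' : ∀ i, Integrable (fun x : ι → ℝ => (m' i - m i) * (x i - m i) / v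
      - (m' i - m i) ^ 2 / (2 * v)) (Measure.pi fun i => gaussianReal (m' i) v) :=
    fun i => (hev i).integrable_comp_of_integrable (hi i)
  refine relEntropyLE_of_withDensity (L := fun x => ∑ i, ((m' i - m i) * (x i - m i) / v
    - (m' i - m i) ^ 2 / (2 * v))) (by fun_prop) ?_ (integrable_finsetSum _ fun i _ => hi' i)
    (le_of_eq ?_)
  · rw [pi_withDensity _ _ (fun i => by fun_prop)
      fun i => gaussianReal_eq_withDensity (m i) (m' i) hv]
    congr 1
    ext x
    rw [Real.exp_sum, ENNReal.ofReal_prod_of_nonneg fun i _ => (Real.exp_pos _).le]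
  · rw [integral_finsetSum _ fun i _ => hi' i]
    refine Finset.sum_congr rfl fun i _ => ?_
    exact (integral_comp_eval (μ := fun i => gaussianReal (m' i) v) (hi i).1).trans (hint i)

/-- The σ-algebras generated by the coordinates whose code is less than `N`. -/
noncomputable def coordinateFiltration {ι : Type*} [Encodable ι] (X : ι → Type*) [∀ i, MeasurableSpace (X i)] :
    Filtration ℕ (MeasurableSpace.pi : MeasurableSpace (∀ i, X i)) where
  seq N := Filtration.piFinset (X := X)
    ((Finset.range N).preimage Encodable.encode Encodable.encode_injective.injOn)
  mono' N M hNM := (Filtration.piFinset (X := X)).mono fun i hi => by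
    simp only [Finset.mem_preimage, Finset.mem_range] at hi ⊢
    omega
  le' N := (Filtration.piFinset (X := X)).le _

theorem iSup_coordinateFiltration {ι : Type*} [Encodable ι] (X : ι → Type*)
    [∀ i, MeasurableSpace (X i)] : ⨆ N, coordinateFiltration X N = MeasurableSpace.pi := by
  refine le_antisymm (iSup_le fun N => (coordinateFiltration X).le N) ?_
  refine iSup_le fun i => ?_
  -- Stage `N` contains the codes strictly below `N`, so coordinate `i` appears at stage `encode i +
  -- 1`.
  refine le_trans ?_ (le_iSup _ (Encodable.encode i + 1))
  change _ ≤ Filtration.piFinset (X := X) _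
  rw [Filtration.piFinset_eq_comap_restrict]
  have hmem : i ∈ (((Finset.range (Encodable.encode i + 1)).preimage Encodable.encode
    Encodable.encode_injective.injOn : Finset ι) : Set ι) := by simp
  rw [show (fun x : ∀ i, X i => x i) = (fun x => x ⟨i, hmem⟩) ∘ Set.domRestrict _ from rfl,
    ← MeasurableSpace.comap_comp]
  exact MeasurableSpace.comap_mono (measurable_pi_apply (X := fun a : (((Finset.range (Encodable.encode i + 1)).preimage
    Encodable.encode Encodable.encode_injective.injOn : Finset ι) : Set ι) => X a)
    ⟨i, hmem⟩).comap_le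

/-- By Lévy's upward theorem a bounded `f` is an almost everywhere limit of functions of finitely
many coordinates. Both sides of the dual inequality pass to the limit by dominated convergence. -/
theorem relEntropyLE_infinitePi {ι : Type*} [Encodable ι] {X : ι → Type*}
    [∀ i, MeasurableSpace (X i)] (P Q : ∀ i, Measure (X i)) [∀ i, IsProbabilityMeasure (P i)]
    [∀ i, IsProbabilityMeasure (Q i)] {K : ℝ}
    (h : ∀ J : Finset ι, RelEntropyLE K (Measure.pi fun i : J => Q i) (Measure.pi fun i : J => P i)) :
    RelEntropyLE K (Measure.infinitePi Q) (Measure.infinitePi P) := by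
  rintro f hf ⟨C, hC⟩
  -- Conditioning under the sum makes a single approximating sequence converge almost everywhere for
  -- both measures.
  set μ := Measure.infinitePi Q + Measure.infinitePi P with hμ
  have hfi : Integrable f μ := integrable_of_measurable_of_norm_le μ hf.stronglyMeasurable hC
  set J : ℕ → Finset ι := fun N =>
    (Finset.range N).preimage Encodable.encode Encodable.encode_injective.injOn
  have hlim := tendsto_ae_condExp (μ := μ) (ℱ := coordinateFiltration X) f
  rw [iSup_coordinateFiltration, condExp_of_stronglyMeasurable le_rfl hf.stronglyMeasurable hfi]
    at hlim
  have hfac : ∀ N, ∃ k : (∀ i : J N, X i) → ℝ, Measurable k ∧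
      μ[f | coordinateFiltration X N] = k ∘ (J N).restrict := fun N =>
    Measurable.exists_eq_measurable_comp (f := (J N).restrict)
      (stronglyMeasurable_condExp (m := coordinateFiltration X N)).measurable
  choose k hk hkeq using hfac
  -- The factorized conditional expectation is only almost everywhere bounded. Clamping bounds it
  -- everywhere and keeps the limit, since `|f| ≤ C`.
  set k' : ∀ N, (∀ i : J N, X i) → ℝ := fun N x => max (-C) (min C (k N x)) with hk'
  have hk'm : ∀ N, Measurable (k' N) := fun N =>
    measurable_const.max (measurable_const.min (hk N))
  obtain ⟨x₀⟩ : Nonempty (∀ i, X i) :=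
    nonempty_of_isProbabilityMeasure (Measure.infinitePi P)
  have hC0 : 0 ≤ C := (abs_nonneg _).trans (hC x₀)
  have hk'C : ∀ N x, |k' N x| ≤ C := fun N x =>
    abs_le.2 ⟨le_max_left _ _, max_le (by linarith) (min_le_left _ _)⟩
  have hlim' : ∀ᵐ x ∂μ, Tendsto (fun N => k' N ((J N).restrict x)) atTop (𝓝 (f x)) := by
    filter_upwards [hlim] with x hx
    have h1 : Tendsto (fun N => max (-C) (min C ((μ[f | coordinateFiltration X N]) x))) atTop
        (𝓝 (max (-C) (min C (f x)))) := tendsto_const_nhds.max (tendsto_const_nhds.min hx)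
    rw [min_eq_right (abs_le.1 (hC x)).2, max_eq_right (abs_le.1 (hC x)).1] at h1
    refine h1.congr fun N => ?_
    rw [hkeq N]
    rfl
  have hlimQ : ∀ᵐ x ∂(Measure.infinitePi Q),
      Tendsto (fun N => k' N ((J N).restrict x)) atTop (𝓝 (f x)) :=
    ae_mono (Measure.le_add_right le_rfl) hlim'
  have hlimP : ∀ᵐ x ∂(Measure.infinitePi P),
      Tendsto (fun N => k' N ((J N).restrict x)) atTop (𝓝 (f x)) :=
    ae_mono (Measure.le_add_left le_rfl) hlim'
  have hm : ∀ N, Measurable fun x : ∀ i, X i => k' N ((J N).restrict x) := fun N =>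
    (hk'm N).comp (Finset.measurable_restrict _)
  have hQ : Tendsto (fun N => ∫ x, k' N ((J N).restrict x) ∂(Measure.infinitePi Q)) atTop
      (𝓝 (∫ x, f x ∂(Measure.infinitePi Q))) :=
    tendsto_integral_of_dominated_convergence (fun _ => C)
      (fun N => (hm N).aestronglyMeasurable) (integrable_const _)
      (fun N => ae_of_all _ fun x => hk'C N _) hlimQ
  have hP : Tendsto (fun N => ∫ x, Real.exp (k' N ((J N).restrict x)) ∂(Measure.infinitePi P)) atTop
      (𝓝 (∫ x, Real.exp (f x) ∂(Measure.infinitePi P))) := by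
    refine tendsto_integral_of_dominated_convergence (fun _ => Real.exp C)
      (fun N => (hm N).exp.aestronglyMeasurable) (integrable_const _)
      (fun N => ae_of_all _ fun x => ?_) ?_
    · rw [Real.norm_eq_abs, Real.abs_exp, Real.exp_le_exp]
      exact (le_abs_self _).trans (hk'C N _)
    · filter_upwards [hlimP] with x hx
      exact (Real.continuous_exp.tendsto _).comp hx
  have hpos : 0 < ∫ x, Real.exp (f x) ∂(Measure.infinitePi P) :=
    integral_exp_pos (integrable_exp_of_abs_le _ hf hC)
  refine le_of_tendsto_of_tendsto' hQ ((hP.log hpos.ne').const_add K) fun N => ?_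
  have e1 := integral_restrict_infinitePi (μ := Q) (hk'm N).aestronglyMeasurable
  have e2 := integral_restrict_infinitePi (μ := P) (hk'm N).exp.aestronglyMeasurable
  rw [e1, e2]
  exact h (J N) (k' N) (hk'm N) ⟨C, hk'C N⟩

theorem RelEntropyLE.mono {Ω : Type*} [MeasurableSpace Ω] {K K' : ℝ} {Q P : Measure Ω}
    (h : RelEntropyLE K Q P) (hK : K ≤ K') : RelEntropyLE K' Q P := fun f hf hb =>
  (h f hf hb).trans (add_le_add_left hK _)

instance {ι H : Type*} [NormedAddCommGroup H] [InnerProductSpace ℝ H] (b : HilbertBasis ι ℝ H)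
    (w : H) (σ : ℝ) : IsProbabilityMeasure (gaussian b w σ) := by
  unfold gaussian
  infer_instance

/-- Bessel's inequality bounds every finite sum of squared coordinate shifts by `‖w - w₀‖²`,
uniformly in the finite set. -/
theorem relEntropyLE_gaussian {ι H : Type*} [Encodable ι] [NormedAddCommGroup H]
    [InnerProductSpace ℝ H] (b : HilbertBasis ι ℝ H) (w w₀ : H) {σ : ℝ} (hσ : 0 < σ) :
    RelEntropyLE (‖w - w₀‖ ^ 2 / (2 * σ ^ 2)) (gaussian b w σ) (gaussian b w₀ σ) := by
  have hv : (σ ^ 2).toNNReal ≠ 0 := by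
    rw [Ne, Real.toNNReal_eq_zero, not_le]
    positivity
  refine relEntropyLE_infinitePi _ _ fun J => ?_
  refine (relEntropyLE_pi_gaussianReal (fun i : J => inner ℝ (b i) w₀)
    (fun i : J => inner ℝ (b i) w) hv).mono ?_
  rw [Real.coe_toNNReal _ (by positivity), ← Finset.sum_div]
  refine div_le_div_of_nonneg_right ?_ (by positivity)
  rw [Finset.sum_coe_sort J fun i => (inner ℝ (b i) w - inner ℝ (b i) w₀) ^ 2]
  refine le_trans (le_of_eq ?_) (b.orthonormal.sum_inner_products_le (s := J) (x := w - w₀))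
  refine Finset.sum_congr rfl fun i _ => ?_
  rw [inner_sub_right, Real.norm_eq_abs, sq_abs]

end DonskerVaradhan

end PacBayesSVM

namespace PacBayesSVM

/-! ### Variational form of the binary divergence and its exponential moment. -/

section Kl

/-- The affine-in-`q` minorants of `klPlus q p`, whose supremum over `L ≥ 0` is `klPlus q p`. -/
noncomputable def klMinorant (L q p : ℝ) : ℝ := -(L * q) - Real.log (1 - p + p * Real.exp (-L))

theorem one_sub_add_mul_exp_pos {p : ℝ} (h0 : 0 ≤ p) (h1 : p ≤ 1) (L : ℝ) :
    0 < 1 - p + p * Real.exp (-L) := by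
  rcases h1.eq_or_lt with rfl | h1
  · simpa using Real.exp_pos (-L)
  · exact add_pos_of_pos_of_nonneg (sub_pos.2 h1) (mul_nonneg h0 (Real.exp_pos _).le)

theorem klPlus_le_of_klMinorant_le {q p B : ℝ} (hq : q ∈ Set.Icc (0 : ℝ) 1)
    (hp : p ∈ Set.Icc (0 : ℝ) 1) (h : ∀ L, 0 ≤ L → klMinorant L q p ≤ B) :
    klPlus q p ≤ (B : EReal) := by
  have hB : 0 ≤ B := by simpa [klMinorant] using h 0 le_rfl
  unfold klPlus
  split_ifs with hqp hp1
  · exfalso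
    subst hp1
    -- At `p = 1` the minorant is `L (1 - q)`, which is unbounded in `L`. This `L` gives it the
    -- value `B + 1`.
    have h1 := h ((B + 1) / (1 - q)) (div_nonneg (by linarith) (by linarith))
    simp only [klMinorant, sub_self, one_mul, zero_add, Real.log_exp] at h1
    have h2 : (B + 1) / (1 - q) * (1 - q) = B + 1 := div_mul_cancel₀ _ (by linarith)
    linarith
  · have hp1' : 0 < 1 - p := sub_pos.2 (lt_of_le_of_ne hp.2 hp1)
    have hp0 : 0 < p := hq.1.trans_lt hqp
    rw [EReal.coe_le_coe_iff]
    rcases hq.1.eq_or_lt with rfl | hq0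
    -- For `q = 0` the supremum is not attained but approached as `L → ∞`.
    · have hlim : Tendsto (fun L => klMinorant L 0 p) atTop (𝓝 (-Real.log (1 - p + p * 0))) := by
        have e : (fun L => klMinorant L 0 p)
            = fun L => -Real.log (1 - p + p * Real.exp (-L)) := by
          ext L
          simp [klMinorant]
        rw [e]
        refine ((Tendsto.const_add (1 - p) ((Real.tendsto_exp_neg_atTop_nhds_zero).const_mul p)).log
          ?_).neg
        rw [mul_zero, add_zero]
        exact hp1'.ne'
      have h1 := le_of_tendsto hlim (eventually_ge_atTop 0 |>.mono h)
      simpa [Real.log_inv] using h1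
    · have hq1 : 0 < 1 - q := by linarith
      -- The logarithm of this ratio is the maximizing `L`. It is nonnegative because `q < p`.
      have hr : 1 ≤ p * (1 - q) / (q * (1 - p)) := by
        rw [le_div_iff₀ (by positivity)]
        linarith
      have h1 := h (Real.log (p * (1 - q) / (q * (1 - p)))) (Real.log_nonneg hr)
      rw [klMinorant, ← Real.log_inv, Real.exp_log (by positivity)] at h1
      have e : 1 - p + p * (p * (1 - q) / (q * (1 - p)))⁻¹ = (1 - p) / (1 - q) := by
        field_simp
        ring
      rw [e, Real.log_div hp1'.ne' hq1.ne', Real.log_div (by positivity) (by positivity),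
        Real.log_mul hp0.ne' hq1.ne', Real.log_mul hq0.ne' hp1'.ne'] at h1
      rw [Real.log_div hq0.ne' hp0.ne', Real.log_div hq1.ne' hp1'.ne']
      linarith
  · exact_mod_cast hB

/-- Continuity in `L` reduces the supremum to a countable one, which keeps it measurable. The
absolute value lets the index range over all of `ℚ`. -/
theorem klMinorant_le_of_rat {q p B : ℝ} (hp : p ∈ Set.Icc (0 : ℝ) 1)
    (h : ∀ r : ℚ, klMinorant |(r : ℝ)| q p ≤ B) (L : ℝ) (hL : 0 ≤ L) : klMinorant L q p ≤ B := by
  have hc : Continuous fun x : ℝ => klMinorant |x| q p := by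
    unfold klMinorant
    exact (by fun_prop : Continuous fun x : ℝ => -(|x| * q)).sub
      ((by fun_prop : Continuous fun x : ℝ => 1 - p + p * Real.exp (-|x|)).log
        fun x => (one_sub_add_mul_exp_pos hp.1 hp.2 _).ne')
  have h1 := Rat.denseRange_cast.induction_on (p := fun x : ℝ => klMinorant |x| q p ≤ B) L
    (isClosed_le hc continuous_const) h
  simpa only [abs_of_nonneg hL] using h1

/-- With the tilted parameter `θ = p exp(-L) / (1 - p + p exp(-L))`, this is the likelihood ratio of
Bernoulli(`θ`) to Bernoulli(`p`) at a fractional observation `q`. All dependence on `L` thus sits in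
`θ`. -/
theorem exp_klMinorant {q p : ℝ} (hp : p ∈ Set.Ioo (0 : ℝ) 1) (L : ℝ) :
    Real.exp (klMinorant L q p)
      = (p * Real.exp (-L) / (1 - p + p * Real.exp (-L)) * p⁻¹) ^ q
        * ((1 - p * Real.exp (-L) / (1 - p + p * Real.exp (-L))) * (1 - p)⁻¹) ^ (1 - q) := by
  have hZ := one_sub_add_mul_exp_pos hp.1.le hp.2.le L
  set Z := 1 - p + p * Real.exp (-L) with hZdef
  have hp0 := hp.1.ne'
  have hp1 : (1 - p) ≠ 0 := (sub_pos.2 hp.2).ne'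
  have e1 : p * Real.exp (-L) / Z * p⁻¹ = Real.exp (-L) / Z := by field_simp
  have e2 : (1 - p * Real.exp (-L) / Z) * (1 - p)⁻¹ = Z⁻¹ := by
    rw [one_sub_div hZ.ne', show Z - p * Real.exp (-L) = 1 - p by rw [hZdef]; ring]
    field_simp
  rw [e1, e2, Real.rpow_def_of_pos (div_pos (Real.exp_pos _) hZ),
    Real.rpow_def_of_pos (inv_pos.2 hZ), ← Real.exp_add, Real.log_div (Real.exp_pos _).ne' hZ.ne',
    Real.log_exp, Real.log_inv, klMinorant]
  congr 1
  ring

/-- A concavity bound: the `n`-th power of `θ ↦ (θ a) ^ q ((1 - θ) b) ^ (1 - q)` is at most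
`n + 1` times its mean over `[0, 1]`. -/
theorem pow_le_integral_pow {q a b θ : ℝ} (hq : q ∈ Set.Icc (0 : ℝ) 1) (ha : 0 ≤ a) (hb : 0 ≤ b)
    (hθ : θ ∈ Set.Ioo (0 : ℝ) 1) (n : ℕ) :
    ((θ * a) ^ q * ((1 - θ) * b) ^ (1 - q)) ^ n
      ≤ (n + 1) * ∫ x in (0 : ℝ)..1, ((x * a) ^ q * ((1 - x) * b) ^ (1 - q)) ^ n := by
  set F : ℝ → ℝ := fun x => (x * a) ^ q * ((1 - x) * b) ^ (1 - q) with hF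
  have hθ0 := hθ.1
  have hθ1 : 0 < 1 - θ := sub_pos.2 hθ.2
  have hFc : Continuous F := by
    have h1 := Real.continuous_rpow_const hq.1
    have h2 := Real.continuous_rpow_const (sub_nonneg.2 hq.2)
    exact (h1.comp (by fun_prop : Continuous fun x : ℝ => x * a)).mul
      (h2.comp (by fun_prop : Continuous fun x : ℝ => (1 - x) * b))
  have hF0 : 0 ≤ F θ := by
    have := hθ1.le
    positivity
  -- `F` is monotone and homogeneous of degree 1 in the pair `(x, 1 - x)`, so it lies above the tent
  -- with apex `F θ` at `θ`. The `n`-th power of the tent integrates to `F θ ^ n / (n + 1)`.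
  have hscale : ∀ t x : ℝ, 0 ≤ t → t * θ ≤ x → t * (1 - θ) ≤ 1 - x → t * F θ ≤ F x := by
    intro t x ht h1 h2
    have e : t * F θ = (t * θ * a) ^ q * (t * (1 - θ) * b) ^ (1 - q) := by
      rw [hF]
      simp only
      rw [mul_assoc t, mul_assoc t, Real.mul_rpow ht (by positivity),
        Real.mul_rpow ht (by positivity)]
      have : t = t ^ q * t ^ (1 - q) := by
        rw [← Real.rpow_add_of_nonneg ht hq.1 (sub_nonneg.2 hq.2), add_sub_cancel, Real.rpow_one]
      nth_rewrite 1 [this]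
      ring
    rw [e]
    have h3 : 0 ≤ t * θ := by positivity
    have h4 : 0 ≤ t * (1 - θ) := by positivity
    refine mul_le_mul (Real.rpow_le_rpow (by positivity) (by gcongr) hq.1)
      (Real.rpow_le_rpow (by positivity) (by gcongr) (sub_nonneg.2 hq.2)) (by positivity) ?_
    have := h3.trans h1
    positivity
  have hi : ∀ u v : ℝ, IntervalIntegrable (fun x => F x ^ n) volume u v := fun u v =>
    (hFc.pow n).intervalIntegrable u v
  have hleft : F θ ^ n * (θ / (n + 1)) ≤ ∫ x in (0 : ℝ)..θ, F x ^ n := by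
    have hval : ∫ x in (0 : ℝ)..θ, (x / θ * F θ) ^ n = F θ ^ n * (θ / (n + 1)) := by
      simp_rw [mul_pow, div_pow]
      rw [intervalIntegral.integral_mul_const, intervalIntegral.integral_div, integral_pow]
      field_simp
      ring
    rw [← hval]
    refine intervalIntegral.integral_mono_on hθ0.le
      (Continuous.intervalIntegrable (by fun_prop) _ _) (hi _ _) fun x hx => ?_
    refine pow_le_pow_left₀ (mul_nonneg (div_nonneg hx.1 hθ0.le) hF0)
      (hscale _ _ (div_nonneg hx.1 hθ0.le) (div_mul_cancel₀ _ hθ0.ne').le ?_) n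
    rw [mul_sub, mul_one, div_mul_cancel₀ _ hθ0.ne']
    exact sub_le_sub_right ((div_le_one hθ0).2 hx.2) _
  have hright : F θ ^ n * ((1 - θ) / (n + 1)) ≤ ∫ x in θ..1, F x ^ n := by
    have hval : ∫ x in θ..1, ((1 - x) / (1 - θ) * F θ) ^ n = F θ ^ n * ((1 - θ) / (n + 1)) := by
      have := intervalIntegral.integral_comp_sub_left
        (fun x => (x / (1 - θ) * F θ) ^ n) (a := θ) (b := 1) 1
      rw [this]
      simp_rw [mul_pow, div_pow]
      rw [intervalIntegral.integral_mul_const, intervalIntegral.integral_div, integral_pow]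
      field_simp
      ring
    rw [← hval]
    refine intervalIntegral.integral_mono_on hθ.2.le
      (Continuous.intervalIntegrable (by fun_prop) _ _) (hi _ _) fun x hx => ?_
    have hx1 : 0 ≤ 1 - x := sub_nonneg.2 hx.2
    refine pow_le_pow_left₀ (mul_nonneg (div_nonneg hx1 hθ1.le) hF0)
      (hscale _ _ (div_nonneg hx1 hθ1.le) ?_ (div_mul_cancel₀ _ hθ1.ne').le) n
    have h1 : (1 - x) / (1 - θ) * (1 - θ) = 1 - x := div_mul_cancel₀ _ hθ1.ne'
    have h2 : (1 - x) / (1 - θ) ≤ 1 := (div_le_one hθ1).2 (by linarith [hx.1])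
    linarith
  rw [← intervalIntegral.integral_add_adjacent_intervals (hi 0 θ) (hi θ 1)]
  calc F θ ^ n = (n + 1) * (F θ ^ n * (θ / (n + 1)) + F θ ^ n * ((1 - θ) / (n + 1))) := by
        field_simp
        ring
    _ ≤ _ := mul_le_mul_of_nonneg_left (add_le_add hleft hright) (by positivity)

/-- Weighted AM-GM in each factor. The resulting product of functions of single observations can be
integrated by independence. -/
theorem pow_rpow_mean_le_prod {n : ℕ} (hn : 1 ≤ n) {x : Fin n → ℝ}
    (hx : ∀ i, x i ∈ Set.Icc (0 : ℝ) 1) {A B : ℝ} (hA : 0 ≤ A) (hB : 0 ≤ B) :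
    (A ^ (1 / (n : ℝ) * ∑ i, x i) * B ^ (1 - 1 / (n : ℝ) * ∑ i, x i)) ^ n
      ≤ ∏ i, (x i * A + (1 - x i) * B) := by
  have hn' : (n : ℝ) ≠ 0 := by positivity
  have e1 : 1 / (n : ℝ) * (∑ i, x i) * n = ∑ i, x i := by field_simp
  have e2 : (1 - 1 / (n : ℝ) * ∑ i, x i) * n = ∑ i, (1 - x i) := by
    rw [Finset.sum_sub_distrib]
    simp
    field_simp
  rw [mul_pow, ← Real.rpow_mul_natCast hA, ← Real.rpow_mul_natCast hB, e1, e2,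
    Real.rpow_sum_of_nonneg hA fun i _ => (hx i).1,
    Real.rpow_sum_of_nonneg hB fun i _ => sub_nonneg.2 (hx i).2, ← Finset.prod_mul_distrib]
  refine Finset.prod_le_prod (fun i _ => by positivity) fun i _ => ?_
  exact Real.geom_mean_le_arith_mean2_weighted (hx i).1 (sub_nonneg.2 (hx i).2) hA hB
    (add_sub_cancel _ _)

theorem mean_mem_Icc {n : ℕ} (hn : 1 ≤ n) {x : Fin n → ℝ} (hx : ∀ i, x i ∈ Set.Icc (0 : ℝ) 1) :
    1 / (n : ℝ) * ∑ i, x i ∈ Set.Icc (0 : ℝ) 1 := by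
  have hn' : (0 : ℝ) < n := by exact_mod_cast hn
  refine ⟨mul_nonneg (by positivity) (Finset.sum_nonneg fun i _ => (hx i).1), ?_⟩
  rw [one_div, inv_mul_le_one₀ hn']
  exact (Finset.sum_le_sum fun i _ => (hx i).2).trans (by simp)

/-- The exponential moment of `n * klPlus` between the empirical mean and the mean of a random
variable with values in `[0, 1]` is at most `n + 1`. -/
theorem lintegral_iSup_exp_klMinorant_le {Ω : Type*} [MeasurableSpace Ω] (P : Measure Ω)
    [IsProbabilityMeasure P] {x : Ω → ℝ} (hx : Measurable x) (hx01 : ∀ z, x z ∈ Set.Icc (0 : ℝ) 1)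
    {n : ℕ} (hn : 1 ≤ n) :
    ∫⁻ s : Fin n → Ω, ⨆ r : ℚ, ENNReal.ofReal (Real.exp (n * klMinorant |(r : ℝ)|
      (1 / (n : ℝ) * ∑ i, x (s i)) (∫ z, x z ∂P))) ∂(Measure.pi fun _ => P) ≤ n + 1 := by
  have hn' : (0 : ℝ) < n := by exact_mod_cast hn
  have hxi : Integrable x P := integrable_of_measurable_of_norm_le P hx.stronglyMeasurable (M := 1)
    fun z => by rw [Real.norm_eq_abs, abs_of_nonneg (hx01 z).1]; exact (hx01 z).2
  set p := ∫ z, x z ∂P with hp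
  have hp0 : 0 ≤ p := integral_nonneg fun z => (hx01 z).1
  have hp1 : p ≤ 1 := by
    refine (integral_mono hxi (integrable_const 1) fun z => (hx01 z).2).trans ?_
    simp
  -- For `p = 0` or `p = 1` the minorants are almost surely nonpositive. These cases are split off
  -- because the main argument divides by `p` and `1 - p`.
  have htriv : (∀ᵐ s : Fin n → Ω ∂(Measure.pi fun _ => P), ∀ r : ℚ,
      klMinorant |(r : ℝ)| (1 / (n : ℝ) * ∑ i, x (s i)) p ≤ 0) →
      ∫⁻ s : Fin n → Ω, ⨆ r : ℚ, ENNReal.ofReal (Real.exp (n * klMinorant |(r : ℝ)|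
      (1 / (n : ℝ) * ∑ i, x (s i)) p)) ∂(Measure.pi fun _ => P) ≤ n + 1 := by
    intro h
    calc _ ≤ ∫⁻ s : Fin n → Ω, 1 ∂(Measure.pi fun _ => P) := by
          refine lintegral_mono_ae ?_
          filter_upwards [h] with s hs
          refine iSup_le fun r => ?_
          rw [ENNReal.ofReal_le_one, Real.exp_le_one_iff]
          exact mul_nonpos_of_nonneg_of_nonpos hn'.le (hs r)
      _ ≤ n + 1 := by simp
  rcases hp0.eq_or_lt with hp0 | hp0
  · refine htriv (ae_of_all _ fun s r => ?_)
    rw [← hp0]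
    simp only [klMinorant, sub_zero, zero_mul, add_zero, Real.log_one, neg_nonpos]
    exact mul_nonneg (abs_nonneg _) (mean_mem_Icc hn fun i => hx01 (s i)).1
  rcases hp1.eq_or_lt with hp1 | hp1
  · have hae : ∀ᵐ z ∂P, x z = 1 := by
      have h0 : ∫ z, (1 - x z) ∂P = 0 := by
        rw [integral_sub (integrable_const _) hxi, ← hp, hp1]
        simp
      have := (integral_eq_zero_iff_of_nonneg (fun z => sub_nonneg.2 (hx01 z).2)
        ((integrable_const _).sub hxi)).1 h0
      filter_upwards [this] with z hz
      simp only [Pi.zero_apply] at hz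
      linarith
    have hae' : ∀ᵐ s : Fin n → Ω ∂(Measure.pi fun _ => P), ∀ i, x (s i) = 1 :=
      ae_all_iff.2 fun i => (measurePreserving_eval (fun _ : Fin n => P) i).quasiMeasurePreserving.ae hae
    refine htriv ?_
    filter_upwards [hae'] with s hs r
    simp only [hs, hp1, klMinorant]
    simp [hn'.ne']
  have hp1' : 0 < 1 - p := sub_pos.2 hp1
  have hmeas : Measurable fun z : (Fin n → Ω) × ℝ =>
      ∏ i, ENNReal.ofReal (x (z.1 i) * (z.2 * p⁻¹) + (1 - x (z.1 i)) * ((1 - z.2) * (1 - p)⁻¹)) := by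
    fun_prop
  calc
    -- The mixture over `θ` does not involve `r`, so it dominates all `r` at once and the supremum
    -- inside the integral costs nothing.
    _ ≤ ∫⁻ s : Fin n → Ω, ((n + 1) * ∫⁻ θ in Set.Icc (0 : ℝ) 1, ∏ i, ENNReal.ofReal
          (x (s i) * (θ * p⁻¹) + (1 - x (s i)) * ((1 - θ) * (1 - p)⁻¹)))
          ∂(Measure.pi fun _ => P) := by
        refine lintegral_mono fun s => iSup_le fun r => ?_
        have hq := mean_mem_Icc hn fun i => hx01 (s i)
        set q := 1 / (n : ℝ) * ∑ i, x (s i) with hqdef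
        have hZ := one_sub_add_mul_exp_pos hp0.le hp1.le |(r : ℝ)|
        have hθ : p * Real.exp (-|(r : ℝ)|) / (1 - p + p * Real.exp (-|(r : ℝ)|))
            ∈ Set.Ioo (0 : ℝ) 1 :=
          ⟨by positivity, by rw [div_lt_one hZ]; linarith⟩
        have h1 := pow_le_integral_pow hq (inv_pos.2 hp0).le (inv_pos.2 hp1').le hθ n
        rw [← exp_klMinorant ⟨hp0, hp1⟩, ← Real.exp_nat_mul] at h1
        refine (ENNReal.ofReal_le_ofReal h1).trans ?_
        rw [ENNReal.ofReal_mul (by positivity), ENNReal.ofReal_add (by positivity) zero_le_one,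
          ENNReal.ofReal_natCast, ENNReal.ofReal_one]
        refine mul_le_mul_right ?_ _
        have hFc : Continuous fun θ : ℝ => (θ * p⁻¹) ^ q * ((1 - θ) * (1 - p)⁻¹) ^ (1 - q) := by
          have h1 := Real.continuous_rpow_const hq.1
          have h2 := Real.continuous_rpow_const (sub_nonneg.2 hq.2)
          exact (h1.comp (by fun_prop : Continuous fun θ : ℝ => θ * p⁻¹)).mul
            (h2.comp (by fun_prop : Continuous fun θ : ℝ => (1 - θ) * (1 - p)⁻¹))
        rw [intervalIntegral.integral_of_le zero_le_one, ← integral_Icc_eq_integral_Ioc,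
          ofReal_integral_eq_lintegral_ofReal (f := fun θ : ℝ =>
            ((θ * p⁻¹) ^ q * ((1 - θ) * (1 - p)⁻¹) ^ (1 - q)) ^ n)
            ((hFc.pow n).integrableOn_Icc (μ := volume))]
        · refine setLIntegral_mono' measurableSet_Icc fun θ hθ => ?_
          have hA : 0 ≤ θ * p⁻¹ := mul_nonneg hθ.1 (inv_pos.2 hp0).le
          have hB : 0 ≤ (1 - θ) * (1 - p)⁻¹ :=
            mul_nonneg (sub_nonneg.2 hθ.2) (inv_pos.2 hp1').le
          rw [← ENNReal.ofReal_prod_of_nonneg fun i _ => add_nonneg (mul_nonneg (hx01 _).1 hA)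
            (mul_nonneg (sub_nonneg.2 (hx01 _).2) hB)]
          exact ENNReal.ofReal_le_ofReal
            (pow_rpow_mean_le_prod hn (fun i => hx01 (s i)) hA hB)
        · refine (ae_restrict_iff' measurableSet_Icc).2 (ae_of_all _ fun θ hθ => ?_)
          have hA : 0 ≤ θ * p⁻¹ := mul_nonneg hθ.1 (inv_pos.2 hp0).le
          have hB : 0 ≤ (1 - θ) * (1 - p)⁻¹ :=
            mul_nonneg (sub_nonneg.2 hθ.2) (inv_pos.2 hp1').le
          exact pow_nonneg (mul_nonneg (Real.rpow_nonneg hA _) (Real.rpow_nonneg hB _)) n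
    _ = (n + 1) * ∫⁻ θ in Set.Icc (0 : ℝ) 1, ∫⁻ s : Fin n → Ω, ∏ i, ENNReal.ofReal
          (x (s i) * (θ * p⁻¹) + (1 - x (s i)) * ((1 - θ) * (1 - p)⁻¹))
          ∂(Measure.pi fun _ => P) := by
        rw [lintegral_const_mul _ hmeas.lintegral_prod_right',
          lintegral_lintegral_swap hmeas.aemeasurable]
    _ = (n + 1) * ∫⁻ θ in Set.Icc (0 : ℝ) 1, 1 := by
        congr 1
        refine setLIntegral_congr_fun measurableSet_Icc fun θ hθ => ?_
        have hA : 0 ≤ θ * p⁻¹ := mul_nonneg hθ.1 (inv_pos.2 hp0).le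
        have hB : 0 ≤ (1 - θ) * (1 - p)⁻¹ :=
          mul_nonneg (sub_nonneg.2 hθ.2) (inv_pos.2 hp1').le
        rw [lintegral_pi_prod (fun _ : Fin n => P) (g := fun _ z => ENNReal.ofReal
          (x z * (θ * p⁻¹) + (1 - x z) * ((1 - θ) * (1 - p)⁻¹))) fun i => by fun_prop]
        refine Finset.prod_eq_one fun i _ => ?_
        have hi1 : Integrable (fun z => x z * (θ * p⁻¹)) P := hxi.mul_const _
        have hi2 : Integrable (fun z => 1 - x z) P := (integrable_const _).sub hxi
        have hi3 : Integrable (fun z => (1 - x z) * ((1 - θ) * (1 - p)⁻¹)) P := hi2.mul_const _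
        rw [← ofReal_integral_eq_lintegral_ofReal (f := fun z => x z * (θ * p⁻¹)
          + (1 - x z) * ((1 - θ) * (1 - p)⁻¹)) (hi1.add hi3) (ae_of_all _ fun z => add_nonneg
          (mul_nonneg (hx01 _).1 hA) (mul_nonneg (sub_nonneg.2 (hx01 _).2) hB)),
          integral_add hi1 hi3, integral_mul_const, integral_mul_const,
          integral_sub (integrable_const _) hxi, ← hp]
        simp only [integral_const, probReal_univ, smul_eq_mul, mul_one]
        -- The mean of one factor is `p (θ / p) + (1 - p) (1 - θ) / (1 - p) = 1`.
        rw [ENNReal.ofReal_eq_one]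
        field_simp
        ring
    _ = n + 1 := by simp

end Kl

end PacBayesSVM

namespace PacBayesSVM

/-! ### The PAC-Bayes-kl inequality. -/

section PacBayes

theorem abs_klMinorant_le {L q p : ℝ} (hL : 0 ≤ L) (hq : q ∈ Set.Icc (0 : ℝ) 1)
    (hp : p ∈ Set.Icc (0 : ℝ) 1) : |klMinorant L q p| ≤ L := by
  have hexp : Real.exp (-L) ≤ 1 := Real.exp_le_one_iff.2 (neg_nonpos.2 hL)
  have hZ := one_sub_add_mul_exp_pos hp.1 hp.2 L
  have h1 : Real.log (1 - p + p * Real.exp (-L)) ≤ 0 :=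
    Real.log_nonpos hZ.le (by linarith [mul_le_mul_of_nonneg_left hexp hp.1])
  have h2 : -L ≤ Real.log (1 - p + p * Real.exp (-L)) := by
    rw [Real.le_log_iff_exp_le hZ]
    linarith [mul_le_mul_of_nonneg_left hexp (sub_nonneg.2 hp.2)]
  have h3 : 0 ≤ L * q := mul_nonneg hL hq.1
  have h4 : L * q ≤ L := mul_le_of_le_one_right hL hq.2
  rw [klMinorant, abs_le]
  constructor <;> linarith

theorem measurable_klMinorant {Ω : Type*} [MeasurableSpace Ω] (L : ℝ) {q p : Ω → ℝ}
    (hq : Measurable q) (hp : Measurable p) : Measurable fun x => klMinorant L (q x) (p x) := by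
  unfold klMinorant
  fun_prop

theorem integrable_of_mem_Icc {Ω : Type*} [MeasurableSpace Ω] (Q : Measure Ω)
    [IsFiniteMeasure Q] {f : Ω → ℝ} (hf : Measurable f) (h : ∀ x, f x ∈ Set.Icc (0 : ℝ) 1) :
    Integrable f Q :=
  integrable_of_measurable_of_norm_le Q hf.stronglyMeasurable (M := 1) fun x => by
    rw [Real.norm_eq_abs, abs_of_nonneg (h x).1]
    exact (h x).2

theorem integral_mem_Icc {Ω : Type*} [MeasurableSpace Ω] (Q : Measure Ω)
    [IsProbabilityMeasure Q] {f : Ω → ℝ} (hf : Measurable f) (h : ∀ x, f x ∈ Set.Icc (0 : ℝ) 1) :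
    ∫ x, f x ∂Q ∈ Set.Icc (0 : ℝ) 1 := by
  refine ⟨integral_nonneg fun x => (h x).1, ?_⟩
  refine (integral_mono (integrable_of_mem_Icc Q hf h) (integrable_const 1)
    fun x => (h x).2).trans ?_
  simp

/-- Jensen's inequality for the convex function `klMinorant L`. -/
theorem klMinorant_integral_le {Ω : Type*} [MeasurableSpace Ω] (Q : Measure Ω)
    [IsProbabilityMeasure Q] {L : ℝ} (hL : 0 ≤ L) {q p : Ω → ℝ} (hq : Measurable q)
    (hp : Measurable p) (hq01 : ∀ x, q x ∈ Set.Icc (0 : ℝ) 1)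
    (hp01 : ∀ x, p x ∈ Set.Icc (0 : ℝ) 1) :
    klMinorant L (∫ x, q x ∂Q) (∫ x, p x ∂Q) ≤ ∫ x, klMinorant L (q x) (p x) ∂Q := by
  have hqi := integrable_of_mem_Icc Q hq hq01
  have hpi := integrable_of_mem_Icc Q hp hp01
  have hP := integral_mem_Icc Q hp hp01
  set q₀ := ∫ x, q x ∂Q with hq₀
  set p₀ := ∫ x, p x ∂Q with hp₀
  have hZ₀ := one_sub_add_mul_exp_pos hP.1 hP.2 L
  set Z₀ := 1 - p₀ + p₀ * Real.exp (-L) with hZ₀def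
  have hGi : Integrable (fun x => klMinorant L (q x) (p x)) Q :=
    integrable_of_measurable_of_norm_le Q (measurable_klMinorant L hq hp).stronglyMeasurable
      fun x => abs_klMinorant_le hL (hq01 x) (hp01 x)
  -- The tangent plane at the means, obtained from `log u ≤ u - 1` for the ratio `u` of the two
  -- arguments of the logarithm.
  have htan : ∀ x, klMinorant L q₀ p₀ - L * (q x - q₀)
      + (1 - Real.exp (-L)) / Z₀ * (p x - p₀) ≤ klMinorant L (q x) (p x) := by
    intro x
    have hZ := one_sub_add_mul_exp_pos (hp01 x).1 (hp01 x).2 L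
    have h1 := Real.log_le_sub_one_of_pos (div_pos hZ hZ₀)
    rw [Real.log_div hZ.ne' hZ₀.ne'] at h1
    have h2 : (1 - p x + p x * Real.exp (-L)) / Z₀ - 1
        = -((1 - Real.exp (-L)) / Z₀ * (p x - p₀)) := by
      rw [div_sub_one hZ₀.ne', hZ₀def]
      ring
    simp only [klMinorant]
    rw [← hZ₀def]
    linarith
  have hi1 : Integrable (fun x => klMinorant L q₀ p₀ - L * (q x - q₀)) Q :=
    (integrable_const _).sub ((hqi.sub (integrable_const _)).const_mul _)
  have hi2 : Integrable (fun x => (1 - Real.exp (-L)) / Z₀ * (p x - p₀)) Q :=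
    (hpi.sub (integrable_const _)).const_mul _
  have hi3 : Integrable (fun x => L * (q x - q₀)) Q := (hqi.sub (integrable_const _)).const_mul _
  refine le_trans (le_of_eq ?_) (integral_mono (hi1.add hi2) hGi htan)
  simp only [Pi.add_apply]
  rw [integral_add hi1 hi2, integral_sub (integrable_const _) hi3, integral_const_mul,
    integral_const_mul, integral_sub hqi (integrable_const _),
    integral_sub hpi (integrable_const _), ← hq₀, ← hp₀]
  simp

/-- The PAC-Bayes-kl bound for a loss with values in `[0, 1]`, uniform in the posterior `Q`. -/
theorem pacBayes_klPlus {Θ Z : Type*} [MeasurableSpace Θ] [MeasurableSpace Z] (P : Measure Z)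
    [IsProbabilityMeasure P] (Q₀ : Measure Θ) [IsProbabilityMeasure Q₀] {κ : Θ → Z → ℝ}
    (hκ : Measurable (Function.uncurry κ)) (hκ01 : ∀ v z, κ v z ∈ Set.Icc (0 : ℝ) 1) {n : ℕ}
    (hn : 1 ≤ n) {δ : ℝ} (hδ : 0 < δ) :
    (Measure.pi fun _ : Fin n => P).real {s | ¬ ∀ (Q : Measure Θ) (K : ℝ), IsProbabilityMeasure Q →
      RelEntropyLE K Q Q₀ → klPlus (∫ v, 1 / (n : ℝ) * ∑ i, κ v (s i) ∂Q) (∫ v, ∫ z, κ v z ∂P ∂Q)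
        ≤ (((K + Real.log ((n + 1) / δ)) / n : ℝ) : EReal)} ≤ δ := by
  have hn' : (0 : ℝ) < n := by exact_mod_cast hn
  set R : Θ → ℝ := fun v => ∫ z, κ v z ∂P with hR
  have hκv : ∀ v, Measurable (κ v) := fun v => hκ.comp measurable_prodMk_left
  have hRm : Measurable R := (hκ.stronglyMeasurable.integral_prod_right').measurable
  have hR01 : ∀ v, R v ∈ Set.Icc (0 : ℝ) 1 := fun v => integral_mem_Icc P (hκv v) (hκ01 v)
  have hrm : Measurable fun x : (Fin n → Z) × Θ => 1 / (n : ℝ) * ∑ i, κ x.2 (x.1 i) := by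
    refine measurable_const.mul (Finset.measurable_sum _ fun i _ => ?_)
    exact hκ.comp (measurable_snd.prodMk ((measurable_pi_apply i).comp measurable_fst))
  have hr01 : ∀ (s : Fin n → Z) v, 1 / (n : ℝ) * ∑ i, κ v (s i) ∈ Set.Icc (0 : ℝ) 1 :=
    fun s v => mean_mem_Icc hn fun i => hκ01 v (s i)
  have hFm : Measurable fun x : (Fin n → Z) × Θ => ⨆ r : ℚ, ENNReal.ofReal (Real.exp
      (n * klMinorant |(r : ℝ)| (1 / (n : ℝ) * ∑ i, κ x.2 (x.1 i)) (R x.2))) :=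
    Measurable.iSup fun r => (((measurable_klMinorant _ hrm
      (hRm.comp measurable_snd)).const_mul _).exp).ennreal_ofReal
  set M : (Fin n → Z) → ℝ≥0∞ := fun s => ∫⁻ v, ⨆ r : ℚ, ENNReal.ofReal (Real.exp
      (n * klMinorant |(r : ℝ)| (1 / (n : ℝ) * ∑ i, κ v (s i)) (R v))) ∂Q₀ with hM
  have hMm : Measurable M := hFm.lintegral_prod_right'
  have hMint : ∫⁻ s, M s ∂(Measure.pi fun _ : Fin n => P) ≤ n + 1 := by
    rw [hM, lintegral_lintegral_swap hFm.aemeasurable]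
    calc _ ≤ ∫⁻ v, (n + 1 : ℝ≥0∞) ∂Q₀ := lintegral_mono fun v =>
          lintegral_iSup_exp_klMinorant_le P (hκv v) (hκ01 v) hn
      _ = n + 1 := by simp
  have hmarkov : (Measure.pi fun _ : Fin n => P) {s | ENNReal.ofReal ((n + 1) / δ) ≤ M s}
      ≤ ENNReal.ofReal δ := by
    have hpos : 0 < (n + 1) / δ := by positivity
    refine (meas_ge_le_lintegral_div hMm.aemeasurable (ENNReal.ofReal_pos.2 hpos).ne'
      ENNReal.ofReal_ne_top).trans ?_
    refine (ENNReal.div_le_div_right hMint _).trans (le_of_eq ?_)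
    have : (n + 1 : ℝ≥0∞) = ENNReal.ofReal (n + 1) := by
      rw [ENNReal.ofReal_add hn'.le zero_le_one, ENNReal.ofReal_natCast, ENNReal.ofReal_one]
    rw [this, ← ENNReal.ofReal_div_of_pos hpos]
    congr 1
    field_simp
  -- The bad event lies inside the Markov event, which involves only the prior. This gives
  -- uniformity in `Q`, and monotonicity of the outer measure makes measurability of the bad event
  -- unnecessary.
  refine ENNReal.toReal_le_of_le_ofReal hδ.le ((measure_mono fun s hs => ?_).trans hmarkov)
  by_contra hlt
  simp only [Set.mem_ofPred_eq, not_le] at hlt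
  refine hs fun Q K hQ hK => ?_
  have hrs : Measurable fun v => 1 / (n : ℝ) * ∑ i, κ v (s i) := hrm.comp measurable_prodMk_left
  refine klPlus_le_of_klMinorant_le (integral_mem_Icc Q hrs (hr01 s))
    (integral_mem_Icc Q hRm hR01) (klMinorant_le_of_rat (integral_mem_Icc Q hRm hR01) fun r => ?_)
  have hGm := measurable_klMinorant |(r : ℝ)| hrs hRm
  have hGb : ∀ v, |(n : ℝ) * klMinorant |(r : ℝ)| (1 / (n : ℝ) * ∑ i, κ v (s i)) (R v)|
      ≤ n * |(r : ℝ)| := fun v => by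
    rw [abs_mul, abs_of_pos hn']
    exact mul_le_mul_of_nonneg_left
      (abs_klMinorant_le (abs_nonneg _) (hr01 s v) (hR01 v)) hn'.le
  -- Change of measure from `Q₀` to `Q` for one fixed minorant. The bound on the exponential moment
  -- is the same for every `r`.
  have hDV := hK _ (hGm.const_mul (n : ℝ)) ⟨_, hGb⟩
  rw [integral_const_mul] at hDV
  have hexpi := integrable_exp_of_abs_le Q₀ (hGm.const_mul (n : ℝ)) hGb
  have hle : ∫ v, Real.exp (n * klMinorant |(r : ℝ)| (1 / (n : ℝ) * ∑ i, κ v (s i)) (R v)) ∂Q₀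
      ≤ (n + 1) / δ := by
    rw [← ENNReal.ofReal_le_ofReal_iff (by positivity), ofReal_integral_eq_lintegral_ofReal hexpi
      (ae_of_all _ fun v => (Real.exp_pos _).le)]
    refine (lintegral_mono fun v => ?_).trans hlt.le
    exact le_iSup (fun r : ℚ => ENNReal.ofReal (Real.exp
      (n * klMinorant |(r : ℝ)| (1 / (n : ℝ) * ∑ i, κ v (s i)) (R v)))) r
  have hlog := Real.log_le_log (integral_exp_pos hexpi) hle
  have hJ := klMinorant_integral_le Q (abs_nonneg (r : ℝ)) hrs hRm (hr01 s) hR01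
  rw [le_div_iff₀ hn']
  have := mul_le_mul_of_nonneg_left hJ hn'.le
  linarith

end PacBayes

/-! ### Measurability of the score, and the empirical risk as an average. -/

section Risk

variable {X : Type*} [MeasurableSpace X]

/-- A `limUnder` of measurable functions is measurable even where the limit fails to exist, so
almost sure convergence of the series is not needed. -/
theorem measurable_score {ι H : Type*} [Encodable ι] [NormedAddCommGroup H]
    [InnerProductSpace ℝ H] [MeasurableSpace H] [BorelSpace H] (b : HilbertBasis ι ℝ H)
    {φ : X → H} (hφ : Measurable φ) :
    Measurable fun x : (ι → ℝ) × X => score b x.1 (φ x.2) := by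
  unfold score
  refine (StronglyMeasurable.limUnder fun N => Measurable.stronglyMeasurable ?_).measurable
  refine Finset.measurable_sum _ fun i _ => ?_
  refine ((measurable_pi_apply i).comp measurable_fst).mul ?_
  exact (by fun_prop : Continuous fun h : H => inner ℝ (b i) h).measurable.comp
    (hφ.comp measurable_snd)

theorem risk_empiricalMeasure (ℓ : ℝ → Label → ℝ) (c : X → ℝ)
    (hm : Measurable fun z : X × Label => ℓ (c z.1) z.2) {n : ℕ} (s : Fin n → X × Label) :
    risk ℓ c (empiricalMeasure s) = 1 / (n : ℝ) * ∑ i, ℓ (c (s i).1) (s i).2 := by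
  unfold risk empiricalMeasure
  rw [integral_smul_measure, integral_finsetSum_measure fun i _ =>
    integrable_dirac' hm.stronglyMeasurable enorm_lt_top]
  simp_rw [integral_dirac' _ _ hm.stronglyMeasurable]
  simp

end Risk

end PacBayesSVM

theorem mainTheorem2
    {X H ι : Type*} [MeasurableSpace X]
    [NormedAddCommGroup H] [InnerProductSpace ℝ H] [CompleteSpace H]
    [TopologicalSpace.SeparableSpace H] [MeasurableSpace H] [BorelSpace H]
    [Encodable ι] (b : HilbertBasis ι ℝ H)
    (P : Measure (X × PacBayesSVM.Label)) [IsProbabilityMeasure P]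
    (φ : X → H) (hφ : Measurable φ) (hφ_le : ∀ x, ‖φ x‖ ≤ 1)
    (ℓ : ℝ → PacBayesSVM.Label → ℝ) (hℓ : Measurable (Function.uncurry ℓ))
    (hℓ_mem : ∀ t y, ℓ t y ∈ Set.Icc (0 : ℝ) 1)
    (l : ℝ) (hl : 0 < l) (σ : ℝ) (hσ : 0 < σ) (δ : ℝ) (hδ : δ ∈ Set.Ioo (0 : ℝ) 1)
    (n : ℕ) (hn : 1 ≤ n) :
    1 - 2 * δ ≤ (Measure.pi fun _ : Fin n => P).real
      {s | PacBayesSVM.klPlus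
            (PacBayesSVM.avgRisk b φ ℓ
              (PacBayesSVM.gaussian b (PacBayesSVM.svm φ l s) σ)
              (PacBayesSVM.empiricalMeasure s))
            (PacBayesSVM.avgRisk b φ ℓ
              (PacBayesSVM.gaussian b (PacBayesSVM.svm φ l s) σ) P)
          ≤ (((2 / (σ ^ 2 * l ^ 2 * n) * (1 + Real.sqrt (1 / 2 * Real.log (1 / δ))) ^ 2
                + Real.log ((n + 1) / δ)) / n : ℝ) : EReal)} := by
  open PacBayesSVM in
  have := UniformSpace.secondCountable_of_separable H
  have hn' : (0 : ℝ) < n := by exact_mod_cast hn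
  set W : (Fin n → X × Label) → H := fun s => svm φ l s with hW
  have hWm : StronglyMeasurable W := (measurable_svm hφ hl n).stronglyMeasurable
  have hWb : ∀ s, ‖W s‖ ≤ Real.sqrt (2 / l) := fun s =>
    Real.le_sqrt_of_sq_le ((isSVMSolution_svm φ hl s).norm_sq_le hl)
  have hWd : HasBoundedDifferences (2 / (l * n)) W := fun k s s' hs =>
    (isSVMSolution_svm φ hl s).norm_sub_le hφ_le hl (isSVMSolution_svm φ hl s') k hs
  have hc : 0 < 2 / (l * n) := by positivity
  -- The deterministic centre of the prior.
  set w₀ := ∫ s, W s ∂(Measure.pi fun _ : Fin n => P) with hw₀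
  have hA := hWd.measure_norm_sub_ge_le P hc hn hWm hWb hδ
  set κ : (ι → ℝ) → X × Label → ℝ := fun v z => ℓ (score b v (φ z.1)) z.2 with hκ
  have hκm : Measurable (Function.uncurry κ) :=
    hℓ.comp (((measurable_score b hφ).comp (measurable_fst.prodMk
      (measurable_fst.comp measurable_snd))).prodMk (measurable_snd.comp measurable_snd))
  have hB := pacBayes_klPlus P (gaussian b w₀ σ) hκm (fun v z => hℓ_mem _ _) hn hδ.1
  set A := {s : Fin n → X × Label | 2 / (l * n) * Real.sqrt n
    * (1 + Real.sqrt (1 / 2 * Real.log (1 / δ))) ≤ ‖W s - w₀‖}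
  set B := {s : Fin n → X × Label | ¬ ∀ (Q : Measure (ι → ℝ)) (K : ℝ), IsProbabilityMeasure Q →
      RelEntropyLE K Q (gaussian b w₀ σ) →
      klPlus (∫ v, 1 / (n : ℝ) * ∑ i, κ v (s i) ∂Q) (∫ v, ∫ z, κ v z ∂P ∂Q)
        ≤ (((K + Real.log ((n + 1) / δ)) / n : ℝ) : EReal)}
  set G := {s : Fin n → X × Label | klPlus
            (avgRisk b φ ℓ (gaussian b (svm φ l s) σ) (empiricalMeasure s))
            (avgRisk b φ ℓ (gaussian b (svm φ l s) σ) P)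
          ≤ (((2 / (σ ^ 2 * l ^ 2 * n) * (1 + Real.sqrt (1 / 2 * Real.log (1 / δ))) ^ 2
                + Real.log ((n + 1) / δ)) / n : ℝ) : EReal)}
  -- A covering with subadditivity replaces passing to complements, so no measurability of the three
  -- events is required.
  have hcover : Set.univ ⊆ (A ∪ B) ∪ G := by
    intro s _
    by_cases hs : s ∈ A ∪ B
    · exact Or.inl hs
    refine Or.inr ?_
    have hsA : ‖W s - w₀‖ < 2 / (l * n) * Real.sqrt n
        * (1 + Real.sqrt (1 / 2 * Real.log (1 / δ))) := not_le.1 fun h => hs (Or.inl h)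
    have hsB := not_not.1 fun h => hs (Or.inr h)
    have hK : RelEntropyLE (2 / (σ ^ 2 * l ^ 2 * n)
        * (1 + Real.sqrt (1 / 2 * Real.log (1 / δ))) ^ 2)
        (gaussian b (W s) σ) (gaussian b w₀ σ) := by
      refine (relEntropyLE_gaussian b (W s) w₀ hσ).mono ?_
      -- The squared radius is `4 / (l² n)` times the squared bracket. Division by `2σ²` produces
      -- the constant `2 / (σ² l² n)`.
      rw [div_le_iff₀ (by positivity)]
      refine (pow_le_pow_left₀ (norm_nonneg _) hsA.le 2).trans (le_of_eq ?_)
      rw [mul_pow, mul_pow, Real.sq_sqrt hn'.le]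
      field_simp
    have h := hsB (gaussian b (W s) σ) _ inferInstance hK
    have hemp : avgRisk b φ ℓ (gaussian b (W s) σ) (empiricalMeasure s)
        = ∫ v, 1 / (n : ℝ) * ∑ i, κ v (s i) ∂(gaussian b (W s) σ) := by
      unfold PacBayesSVM.avgRisk
      refine integral_congr_ae (ae_of_all _ fun v => ?_)
      exact risk_empiricalMeasure ℓ _ (hκm.comp measurable_prodMk_left) s
    rw [← hemp] at h
    exact h
  have h1 : (1 : ℝ) ≤ (Measure.pi fun _ : Fin n => P).real ((A ∪ B) ∪ G) := by
    exact (probReal_univ (μ := Measure.pi fun _ : Fin n => P)).symm.le.trans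
      (measureReal_mono hcover)
  have h2 := measureReal_union_le (μ := Measure.pi fun _ : Fin n => P) (A ∪ B) G
  have h3 := measureReal_union_le (μ := Measure.pi fun _ : Fin n => P) A B
  linarith
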